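/- **Setting.** Let $d\in\{2,3\}$, let $\Omega\subset\mathbb R^d$ be a bounded domain (e.g. Lipschitz; only $\Omega=\operatorname{int}\overline\Omega$ is needed), $T>0$, and $\mathcal A=\prod_{i=1}^D[\alpha_i^{\min},\alpha_i^{\max}]$ with $D\ge 1$ and $\alpha_i^{\min}<\alpha_i^{\max}$. Write $(\cdot,\cdot)_0,\|\cdot\|_0$ for the $L^2(\Omega)$ inner product and norm and $\|v\|_1^2=\|v\|_0^2+\|\nabla v\|_0^2$. For $\alpha\in\mathcal A$, $t\in[0,T]$ let $\mathcal L(\alpha,t):H^1_0(\Omega)\to H^{-1}(\Omega)$ be bounded linear operators (possibly independent of $t$) whose forms $a_{\alpha,t}(v,w)=\langle\mathcal L(\alpha,t)v,w\rangle$ satisfy $c_a\|v\|_1^2\le a_{\alpha,t}(v,v)$ and $a_{\alpha,t}(v,w)\le C_a\|v\|_1\|w\|_1$ with $c_a>0$ and $C_a$ independent of $\alpha,t$; let $f_{\alpha,t}\in H^{-1}(\Omega)$. **Full order model.** Let $\mathcal T_h$ be a conforming, shape-regular, quasi-uniform triangulation of $\Omega$ with $h=\min_{K\in\mathcal T_h}\operatorname{diam}K$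 (each simplex $K$ contains a ball of radius $\operatorname{diam}(K)/\gamma$, and $\operatorname{diam}K\le\gamma h$), $V_h=\{v\in H^1_0(\Omega): v|_K\in\mathbb P_m\ \forall K\in\mathcal T_h\}$ with $m\ge1$, $\xi_1,\dots,\xi_M$ its Lagrange nodal basis, $\mathrm M=\big((\xi_j,\xi_i)_0\big)_{ij}$ the mass matrix, $N\ge 1$, $\Delta t=T/N$, $t_n=n\Delta t$. For each $\alpha\in\mathcal A$ let $u_h^0(\alpha),\dots,u_h^N(\alpha)\in V_h$ satisfy $$\Big(\tfrac{u_h^n-u_h^{n-1}}{\Delta t},v\Big)_0+a_{\alpha,t_n}(u_h^n,v)=f_{\alpha,t_n}(v)\qquad\forall v\in V_h,\ n=1,\dots,N.$$ Assume that, for an integer $p\ge1$, $\alpha\mapsto u_h^k(\alpha)(x)$ is in $C^p(\mathcal A)$ for all $x\in\Omega$, $1\le k\le N$, and $\max_k\sup_{\alpha\in\mathcal A}\sum_{|\mathbf j|\le p}\|D_\alpha^{\mathbf j}u_h^k(\alpha)\|_{L^\infty(\Omega)}\le C_u$. **Sampling and interpolation.** In each direction $i$ let $\hat\alpha_i^1<\dots<\hat\alpha_i^{K_i}$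 be nodes in $[\alpha_i^{\min},\alpha_i^{\max}]$, $\delta_i=\max_j|\hat\alpha_i^{j+1}-\hat\alpha_i^j|$ and $\delta^q=\sum_i\delta_i^q$. Let $\chi^i:\mathcal A\to\mathbb R^{K_i}$ satisfy $\sum_k|\chi^i(\alpha)_k|\le C_e$ and, for all $g\in C^p(\mathcal A)$, $$\sup_{\alpha\in\mathcal A}\Big|g(\alpha)-\sum_{k_1,\dots,k_D}\chi^1(\alpha)_{k_1}\cdots\chi^D(\alpha)_{k_D}\,g(\hat\alpha_1^{k_1},\dots,\hat\alpha_D^{k_D})\Big|\le C_I\,\delta^p\,\|g\|_{C^p(\mathcal A)},\qquad \|g\|_{C^p(\mathcal A)}=\sup_{\mathcal A}\sum_{|\mathbf j|\le p}|D^{\mathbf j}g|.$$ **Tensors.** Let $\mathbf u^j(\alpha)\in\mathbb R^M$ be the nodal coefficient vector of $u_h^j(\alpha)$, $\boldsymbol\Phi_{:,j,k_1,\dots,k_D}=\mathbf u^j(\hat\alpha_1^{k_1},\dots,\hat\alpha_D^{k_D})$ the snapshot tensor, and $\|\boldsymbol\Phi\|_0=\Delta t^{1/2}\max_{k_1,\dots,k_D}\|\mathrm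 M^{1/2}\boldsymbol\Phi_{:,:,k_1,\dots,k_D}\|_F$. Let $\varepsilon\ge0$ and let $\widetilde{\boldsymbol\Phi}$ be a tensor of the same size with $\|\widetilde{\boldsymbol\Phi}-\boldsymbol\Phi\|_0\le\varepsilon\|\boldsymbol\Phi\|_0$. Let $\widetilde U\subset\mathbb R^M$ be the span of the first-mode fibers of $\widetilde{\boldsymbol\Phi}$, $\widetilde U_h\subset V_h$ the space of finite element functions with coefficient vectors in $\widetilde U$, and $\widetilde\Phi(\alpha)=\widetilde{\boldsymbol\Phi}\times_3\chi^1(\alpha)\cdots\times_{D+2}\chi^D(\alpha)\in\mathbb R^{M\times N}$. Let $V_h^\ell(\alpha)$ be the space of finite element functions with coefficient vectors in the span of the first $\ell$ left singular vectors of $\widetilde\Phi(\alpha)$ (those belonging to the singular value $0$, if any, chosen in $\widetilde U$), and $P_\ell$ the $L^2(\Omega)$-orthogonal projection onto $V_h^\ell(\alpha)$. Let $\lambda_1(\alpha)\ge\dots\ge\lambda_N(\alpha)\ge0$ be the eigenvalues of $\big(\tfrac1N(u_h^j(\alpha),u_h^i(\alpha))_0\big)_{ij}$, $\Lambda_\ell=\sup_{\alpha\in\mathcal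 A}\sum_{i=\ell}^N\lambda_i(\alpha)$, and $C_{\rm inv}=\sup_{\alpha\in\mathcal A}c_{\rm inv}(\alpha)$, where $c_{\rm inv}(\alpha)$ is the best constant in $\|v\|_1\le c_{\rm inv}(\alpha)\|v\|_0$ for all $v\in\operatorname{span}\{u_h^1(\alpha),\dots,u_h^N(\alpha)\}+\widetilde U_h$. **Theorem 1.** In this setting, $$\sup_{\alpha\in\mathcal A}\Delta t\sum_{j=1}^N\big\|u_h^j(\alpha)-P_\ell u_h^j(\alpha)\big\|_1^2\le\widetilde C\,C_{\rm inv}^2\big(\varepsilon^2+\delta^{2p}+\Lambda_{\ell+1}\big),$$ where $\widetilde C>0$ is independent of the triangulation (hence of $h$), $\Delta t$, the sampling grid (hence of $\delta$), $\ell$ and $\varepsilon$; it depends only on $\Omega,\mathcal A,T$, the operators and data, $m$, $p$, $\gamma$, $C_u$, $C_e$, $C_I$, $c_a$, $C_a$. -/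

import Mathlib

open MeasureTheory
open scoped ContDiff

noncomputable section

namespace LRTD

/-! ### The space `H¹₀(Ω)` -/

/-- The physical space `ℝ^d`. -/
abbrev Space (d : ℕ) := EuclideanSpace ℝ (Fin d)

/-- Pairs (function, vector field) in `L²(Ω) × L²(Ω)^d` with the norm
`(‖u‖₀² + ‖g‖₀²)^(1/2)`. -/
abbrev PairSpace {d : ℕ} (Ω : Set (Space d)) :=
  WithLp 2 (Lp ℝ 2 (volume.restrict Ω) × Lp (Space d) 2 (volume.restrict Ω))

/-- The pairs `(φ, ∇φ)` with `φ` smooth and compactly supported in `Ω`. -/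
def testPairs {d : ℕ} (Ω : Set (Space d)) : Set (PairSpace Ω) :=
  {w | ∃ φ : Space d → ℝ, ContDiff ℝ ∞ φ ∧ HasCompactSupport φ ∧ tsupport φ ⊆ Ω ∧
    (w.fst : Space d → ℝ) =ᵐ[volume.restrict Ω] φ ∧
    (w.snd : Space d → Space d) =ᵐ[volume.restrict Ω] fun x => gradient φ x}

/-- `H¹₀(Ω)`: the closure of `C_c^∞(Ω)` in the `H¹` norm.  An element is stored as the pair
(function, weak gradient), so that its norm is the full norm
`‖v‖₁ = (‖v‖₀² + ‖∇v‖₀²)^(1/2)`. -/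
def H10 {d : ℕ} (Ω : Set (Space d)) : Submodule ℝ (PairSpace Ω) :=
  (Submodule.span ℝ (testPairs Ω)).topologicalClosure

/-- The embedding `H¹₀(Ω) → L²(Ω)`; `‖toL2 v‖` is `‖v‖₀`, and `inner ℝ (toL2 v) (toL2 w)` is
`(v, w)₀`. -/
def toL2 {d : ℕ} {Ω : Set (Space d)} : H10 Ω →ₗ[ℝ] Lp ℝ 2 (volume.restrict Ω) :=
  (WithLp.fstₗ 2 ℝ _ _).comp (H10 Ω).subtype

/-- A finite-dimensional `W` contains, for every `v`, an element `w` with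
`(v - w, z)₀ = 0` for all `z ∈ W`. -/
theorem exists_l2Proj {d : ℕ} {Ω : Set (Space d)} (W : Submodule ℝ (H10 Ω))
    [FiniteDimensional ℝ W] (v : H10 Ω) :
    ∃ w ∈ W, ∀ z ∈ W, inner ℝ (toL2 (v - w)) (toL2 z) = 0 := by
  obtain ⟨w, hw, hwe⟩ :=
    Submodule.mem_map.1 ((W.map toL2).orthogonalProjectionOnto (toL2 v)).2
  refine ⟨w, hw, fun z hz => ?_⟩
  rw [map_sub, hwe]
  exact Submodule.starProjection_inner_eq_zero (K := W.map toL2) (toL2 v) (toL2 z)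
    (Submodule.mem_map_of_mem hz)

/-- The `L²`-orthogonal projection of `v` onto the finite-dimensional subspace `W`. -/
def l2Proj {d : ℕ} {Ω : Set (Space d)} (W : Submodule ℝ (H10 Ω)) [FiniteDimensional ℝ W]
    (v : H10 Ω) : H10 Ω :=
  Classical.choose (exists_l2Proj W v)

/-! ### Triangulations and Lagrange finite elements -/

/-- A conforming triangulation of `Ω`: a finite simplicial complex whose maximal faces are
`d`-simplices and whose underlying space is the closure of `Ω`. -/
structure Triangulation {d : ℕ} (Ω : Set (Space d)) where
  complex : Geometry.SimplicialComplex ℝ (Space d)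
  finite : complex.faces.Finite
  pure : ∀ s ∈ complex.faces, ∃ t ∈ complex.faces, s ⊆ t ∧ t.card = d + 1
  space_eq : complex.space = closure Ω

namespace Triangulation

variable {d : ℕ} {Ω : Set (Space d)}

/-- The vertex sets of the `d`-simplices. -/
def cells (𝒯 : Triangulation Ω) : Set (Finset (Space d)) :=
  {s | s ∈ 𝒯.complex.faces ∧ s.card = d + 1}

/-- The closed simplex with vertex set `s`. -/
def body (s : Finset (Space d)) : Set (Space d) := convexHull ℝ (s : Set (Space d))

/-- The mesh parameter `h`, the least diameter of a cell. -/
def meshSize (𝒯 : Triangulation Ω) : ℝ := sInf ((fun s => Metric.diam (body s)) '' 𝒯.cells)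

/-- Shape regularity and quasi-uniformity with constant `γ`: every cell `T` contains a ball of
radius `diam T / γ`, and `diam T ≤ γ h`. -/
def IsQuasiUniform (𝒯 : Triangulation Ω) (γ : ℝ) : Prop :=
  ∀ s ∈ 𝒯.cells,
    (∃ c, Metric.closedBall c (Metric.diam (body s) / γ) ⊆ body s) ∧
      Metric.diam (body s) ≤ γ * 𝒯.meshSize

/-- The restriction of `v` to the simplex with vertex set `s` is a polynomial of degree at
most `m`. -/
def IsPolyOn (m : ℕ) (s : Finset (Space d)) (v : H10 Ω) : Prop :=
  ∃ q : MvPolynomial (Fin d) ℝ, q.totalDegree ≤ m ∧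
    ∀ᵐ x ∂(volume.restrict Ω), x ∈ body s →
      (toL2 v : Space d → ℝ) x = MvPolynomial.eval (fun i => x i) q

/-- The finite element space
`V_h = {v ∈ H¹₀(Ω) : v|_T ∈ P_m for all cells T}`. -/
def feSpace (𝒯 : Triangulation Ω) (m : ℕ) : Submodule ℝ (H10 Ω) where
  carrier := {v | ∀ s ∈ 𝒯.cells, IsPolyOn m s v}
  zero_mem' := fun s _ => ⟨0, by simp, by
    rw [map_zero]
    filter_upwards [Lp.coeFn_zero ℝ 2 (volume.restrict Ω)] with x hx _
    rw [hx]; simp⟩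
  add_mem' := by
    intro v w hv hw s hs
    obtain ⟨q, hq, hqe⟩ := hv s hs
    obtain ⟨r, hr, hre⟩ := hw s hs
    refine ⟨q + r, (MvPolynomial.totalDegree_add _ _).trans (max_le hq hr), ?_⟩
    rw [map_add]
    filter_upwards [hqe, hre, Lp.coeFn_add (toL2 v) (toL2 w)] with x h1 h2 h3 hx
    rw [h3, Pi.add_apply, h1 hx, h2 hx, map_add]
  smul_mem' := by
    intro c v hv s hs
    obtain ⟨q, hq, hqe⟩ := hv s hs
    refine ⟨c • q, (MvPolynomial.totalDegree_smul_le _ _).trans hq, ?_⟩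
    rw [map_smul]
    filter_upwards [hqe, Lp.coeFn_smul c (toL2 v)] with x h1 h3 hx
    rw [h3, Pi.smul_apply, h1 hx, MvPolynomial.smul_eval, smul_eq_mul]

/-- The Lagrange nodes of degree `m` in the simplex with vertex set `s`: the points
`∑ (k_v / m) v` with integers `k_v ≥ 0`, `∑ k_v = m`. -/
def latticePoints (m : ℕ) (s : Finset (Space d)) : Set (Space d) :=
  {x | ∃ k : Space d → ℕ, ∑ v ∈ s, k v = m ∧ x = ∑ v ∈ s, ((k v : ℝ) / m) • v}

/-- The Lagrange nodes of the triangulation that lie in the open set `Ω`. -/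
def interiorNodes (𝒯 : Triangulation Ω) (m : ℕ) : Set (Space d) :=
  {x | x ∈ Ω ∧ ∃ s ∈ 𝒯.cells, x ∈ latticePoints m s}

end Triangulation

/-- The nodal (Lagrange) basis `ξ_1, …, ξ_M` of `V_h`: a numbering of the interior Lagrange nodes,
and the basis of `V_h` whose members (through their continuous representatives, which vanish
outside `Ω`) satisfy `ξ_i(x_j) = δ_ij`. -/
structure NodalBasis {d : ℕ} {Ω : Set (Space d)} (𝒯 : Triangulation Ω) (m M : ℕ) where
  node : Fin M → Space d
  node_injective : Function.Injective node
  range_node : Set.range node = 𝒯.interiorNodes m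
  basis : Module.Basis (Fin M) ℝ (𝒯.feSpace m)
  shape : Fin M → Space d → ℝ
  shape_continuous : ∀ i, Continuous (shape i)
  shape_eq_zero : ∀ i, ∀ x ∉ Ω, shape i x = 0
  shape_ae : ∀ i, (toL2 (basis i : H10 Ω) : Space d → ℝ) =ᵐ[volume.restrict Ω] shape i
  shape_node : ∀ i j, shape i (node j) = if i = j then 1 else 0

namespace NodalBasis

variable {d : ℕ} {Ω : Set (Space d)} {𝒯 : Triangulation Ω} {m M : ℕ}

/-- The vector of coefficients of `v ∈ V_h` in the nodal basis. -/
def coeffs (B : NodalBasis 𝒯 m M) (v : 𝒯.feSpace m) : Fin M → ℝ := fun i => B.basis.repr v i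

/-- The value of (the continuous representative of) `v ∈ V_h` at a point. -/
def eval (B : NodalBasis 𝒯 m M) (v : 𝒯.feSpace m) (x : Space d) : ℝ :=
  ∑ i, B.coeffs v i * B.shape i x

/-- The finite element function with given nodal coefficients. -/
def toFE (B : NodalBasis 𝒯 m M) : (Fin M → ℝ) →ₗ[ℝ] H10 Ω :=
  Fintype.linearCombination ℝ (fun i => (B.basis i : H10 Ω))

/-- The mass matrix `M_ij = (ξ_j, ξ_i)₀`. -/
def mass (B : NodalBasis 𝒯 m M) : Matrix (Fin M) (Fin M) ℝ :=
  Matrix.of fun i j => inner ℝ (toL2 (B.basis j : H10 Ω)) (toL2 (B.basis i : H10 Ω))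

end NodalBasis

/-! ### Snapshot tensors -/

/-- `‖Mass^(1/2) A‖_F`, that is `(tr (Aᵀ Mass A))^(1/2)`. -/
def weightedFrobenius {M N : ℕ} (Mass : Matrix (Fin M) (Fin M) ℝ)
    (A : Matrix (Fin M) (Fin N) ℝ) : ℝ :=
  Real.sqrt (Matrix.trace (A.transpose * Mass * A))

/-- Tensors of size `M × N × K_1 × ⋯ × K_D`, seen as families of space-time slices. -/
abbrev Tensor (M N : ℕ) {D : ℕ} (K : Fin D → ℕ) :=
  ((i : Fin D) → Fin (K i)) → Matrix (Fin M) (Fin N) ℝ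

/-- `‖Φ‖₀ = Δt^(1/2) max_k ‖Mass^(1/2) Φ_(xt)(k)‖_F`. -/
def tensorNorm {M N D : ℕ} {K : Fin D → ℕ} (Δt : ℝ) (Mass : Matrix (Fin M) (Fin M) ℝ)
    (Φ : Tensor M N K) : ℝ :=
  Real.sqrt Δt * ⨆ k, weightedFrobenius Mass (Φ k)

/-- The contraction of a tensor with vectors along all parameter modes,
`Φ ×₃ x¹ ×₄ x² ⋯ ×_{D+2} x^D`. -/
def contract {M N D : ℕ} {K : Fin D → ℕ} (Φ : Tensor M N K) (x : (i : Fin D) → Fin (K i) → ℝ) :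
    Matrix (Fin M) (Fin N) ℝ :=
  ∑ k : ((i : Fin D) → Fin (K i)), (∏ i, x i (k i)) • Φ k

/-- The range of the first-mode unfolding: the span of all first-mode fibers. -/
def fiberSpan {M N D : ℕ} {K : Fin D → ℕ} (Φ : Tensor M N K) : Submodule ℝ (Fin M → ℝ) :=
  Submodule.span ℝ {w | ∃ k j, w = fun i => Φ k i j}

/-- `A = S Σ Vᵀ` is a singular value decomposition, with singular values
`σ 0 ≥ σ 1 ≥ ⋯ ≥ 0` (padded by zeros). -/
structure IsSVD {M N : ℕ} (A : Matrix (Fin M) (Fin N) ℝ) (S : Matrix (Fin M) (Fin M) ℝ)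
    (σ : ℕ → ℝ) (V : Matrix (Fin N) (Fin N) ℝ) : Prop where
  left_orthogonal : S ∈ Matrix.orthogonalGroup (Fin M) ℝ
  right_orthogonal : V ∈ Matrix.orthogonalGroup (Fin N) ℝ
  antitone : Antitone σ
  nonneg : ∀ i, 0 ≤ σ i
  zero_of_le : ∀ i, min M N ≤ i → σ i = 0
  eq_mul : A = S * (Matrix.of fun (i : Fin M) (j : Fin N) =>
    if (i : ℕ) = (j : ℕ) then σ i else 0) * V.transpose

/-- The span of the first `ℓ` columns of `S`. -/
def colSpan {M : ℕ} (S : Matrix (Fin M) (Fin M) ℝ) (ℓ : ℕ) : Submodule ℝ (Fin M → ℝ) :=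
  Submodule.span ℝ {w | ∃ i : Fin M, (i : ℕ) < ℓ ∧ w = fun k => S k i}

/-! ### The parameter box, sampling and interpolation -/

/-- The multi-indices `j ∈ ℕ^D` with `|j| ≤ p`. -/
def multiIndices (D p : ℕ) : Finset (Fin D → ℕ) :=
  (Finset.range (p + 1)).biUnion fun n => (Finset.univ : Finset (Fin D)).piAntidiag n

/-- The directions of a multi-index, each `i` repeated `j i` times. -/
def directions {D : ℕ} (j : Fin D → ℕ) : List (Fin D) :=
  (List.finRange D).flatMap fun i => List.replicate (j i) i

/-- The partial derivative `D^j g` on the set `A`. -/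
def partialDeriv {D : ℕ} (A : Set (Fin D → ℝ)) (j : Fin D → ℕ) (g : (Fin D → ℝ) → ℝ)
    (α : Fin D → ℝ) : ℝ :=
  iteratedFDerivWithin ℝ (directions j).length g A α
    (fun r => Pi.single ((directions j).get r) (1 : ℝ))

/-- `‖g‖_{C^p(A)} = sup_{α ∈ A} ∑_{|j| ≤ p} |D^j g(α)|`. -/
def cpNorm {D : ℕ} (A : Set (Fin D → ℝ)) (p : ℕ) (g : (Fin D → ℝ) → ℝ) : ℝ :=
  sSup ((fun α => ∑ j ∈ multiIndices D p, |partialDeriv A j g α|) '' A)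

/-- A Cartesian grid in the box `[lo, hi]`: `K i ≥ 1` increasing nodes in `[lo i, hi i]`. -/
structure SamplingGrid {D : ℕ} (lo hi : Fin D → ℝ) where
  K : Fin D → ℕ
  K_pos : ∀ i, 0 < K i
  node : (i : Fin D) → Fin (K i) → ℝ
  strictMono : ∀ i, StrictMono (node i)
  mem : ∀ i k, node i k ∈ Set.Icc (lo i) (hi i)

namespace SamplingGrid

variable {D : ℕ} {lo hi : Fin D → ℝ}

/-- The sampled parameter with multi-index `k`. -/
def point (G : SamplingGrid lo hi) (k : (i : Fin D) → Fin (G.K i)) : Fin D → ℝ :=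
  fun i => G.node i (k i)

/-- The mesh step `δ_i`, the largest distance of consecutive nodes in direction `i`. -/
def step (G : SamplingGrid lo hi) (i : Fin D) : ℝ :=
  ⨆ j : Fin (G.K i - 1), |G.node i ⟨j, by omega⟩ - G.node i ⟨j + 1, by omega⟩|

/-- `δ^q = ∑_i δ_i^q`. -/
def stepPow (G : SamplingGrid lo hi) (q : ℕ) : ℝ := ∑ i, G.step i ^ q

/-- The interpolation operator with weights `χ`. -/
def interp (G : SamplingGrid lo hi) (χ : (i : Fin D) → (Fin D → ℝ) → Fin (G.K i) → ℝ)
    (g : (Fin D → ℝ) → ℝ) (α : Fin D → ℝ) : ℝ :=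
  ∑ k : ((i : Fin D) → Fin (G.K i)), (∏ i, χ i α (k i)) * g (G.point k)

/-- Stability: the `ℓ¹` norms of all weight vectors are at most `Ce` on the box. -/
def IsStable (G : SamplingGrid lo hi) (χ : (i : Fin D) → (Fin D → ℝ) → Fin (G.K i) → ℝ)
    (Ce : ℝ) : Prop :=
  ∀ α ∈ Set.Icc lo hi, ∀ i, ∑ k, |χ i α k| ≤ Ce

/-- Accuracy of order `p` with constant `CI`. -/
def IsAccurate (G : SamplingGrid lo hi) (χ : (i : Fin D) → (Fin D → ℝ) → Fin (G.K i) → ℝ)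
    (p : ℕ) (CI : ℝ) : Prop :=
  ∀ g : (Fin D → ℝ) → ℝ, ContDiffOn ℝ p g (Set.Icc lo hi) →
    ∀ α ∈ Set.Icc lo hi,
      |g α - G.interp χ g α| ≤ CI * G.stepPow p * cpNorm (Set.Icc lo hi) p g

end SamplingGrid

/-! ### The full order model and derived quantities -/

section FOM

variable {d D : ℕ} {Ω : Set (Space d)} {𝒯 : Triangulation Ω} {m M : ℕ}

/-- `u α n`, `n = 0, …, N`, solves the backward Euler finite element scheme with step
`Δt = T / N` for every parameter `α ∈ A`. -/
def IsFOMSolution (L : (Fin D → ℝ) → ℝ → H10 Ω →L[ℝ] StrongDual ℝ (H10 Ω))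
    (f : (Fin D → ℝ) → ℝ → StrongDual ℝ (H10 Ω)) (A : Set (Fin D → ℝ)) (T : ℝ) (N : ℕ)
    (u : (Fin D → ℝ) → ℕ → 𝒯.feSpace m) : Prop :=
  ∀ α ∈ A, ∀ n < N, ∀ v : 𝒯.feSpace m,
    inner ℝ ((T / N)⁻¹ • (toL2 (u α (n + 1) : H10 Ω) - toL2 (u α n : H10 Ω)))
        (toL2 (v : H10 Ω)) +
      L α ((n + 1 : ℕ) * (T / N)) (u α (n + 1) : H10 Ω) (v : H10 Ω) =
    f α ((n + 1 : ℕ) * (T / N)) (v : H10 Ω)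

/-- Smoothness in the parameter: for `k = 1, …, N` and `x ∈ Ω` the map `α ↦ u^k(α)(x)` is `C^p` on
`A`, and `∑_{|j| ≤ p} ‖D^j_α u^k(α)‖_{L^∞(Ω)} ≤ Cu` for all `α ∈ A`. -/
def IsParamSmooth (B : NodalBasis 𝒯 m M) (A : Set (Fin D → ℝ)) (p N : ℕ) (Cu : ℝ)
    (u : (Fin D → ℝ) → ℕ → 𝒯.feSpace m) : Prop :=
  ∀ k, 1 ≤ k → k ≤ N →
    (∀ x ∈ Ω, ContDiffOn ℝ p (fun α => B.eval (u α k) x) A) ∧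
    ∀ α ∈ A, ∑ j ∈ multiIndices D p,
      eLpNorm (fun x => partialDeriv A j (fun β => B.eval (u β k) x) α) ⊤ (volume.restrict Ω)
        ≤ ENNReal.ofReal Cu

/-- The snapshot matrix `U(α) = [𝐮¹(α), …, 𝐮^N(α)]` for the parameter `α`. -/
def snapshots (B : NodalBasis 𝒯 m M) (u : (Fin D → ℝ) → ℕ → 𝒯.feSpace m) (N : ℕ)
    (α : Fin D → ℝ) : Matrix (Fin M) (Fin N) ℝ :=
  Matrix.of fun i j => B.coeffs (u α (j + 1)) i

/-- The snapshot tensor on a sampling grid. -/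
def snapshotTensor {lo hi : Fin D → ℝ} (B : NodalBasis 𝒯 m M)
    (u : (Fin D → ℝ) → ℕ → 𝒯.feSpace m) (N : ℕ) (G : SamplingGrid lo hi) : Tensor M N G.K :=
  fun k => snapshots B u N (G.point k)

/-- The `L²` correlation matrix `K(α)_ij = N⁻¹ (u^j(α), u^i(α))₀`. -/
def correlation (u : (Fin D → ℝ) → ℕ → 𝒯.feSpace m) (N : ℕ) (α : Fin D → ℝ) :
    Matrix (Fin N) (Fin N) ℝ :=
  Matrix.of fun i j =>
    (N : ℝ)⁻¹ * inner ℝ (toL2 (u α (j + 1) : H10 Ω)) (toL2 (u α (i + 1) : H10 Ω))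

theorem correlation_isHermitian (u : (Fin D → ℝ) → ℕ → 𝒯.feSpace m) (N : ℕ)
    (α : Fin D → ℝ) : (correlation u N α).IsHermitian := by
  ext i j
  simp [correlation, real_inner_comm]

/-- `Λ_ℓ = sup_{α ∈ A} ∑_{i=ℓ}^N λ_i(α)`, where `λ_1(α) ≥ ⋯ ≥ λ_N(α)` are the eigenvalues of the
correlation matrix; in Mathlib's decreasing enumeration, `λ_i(α)` has the index `i - 1`. -/
def eigenTail (u : (Fin D → ℝ) → ℕ → 𝒯.feSpace m) (N : ℕ) (A : Set (Fin D → ℝ)) (ℓ : ℕ) : ℝ :=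
  sSup ((fun α => ∑ i with ℓ ≤ i.val + 1, (correlation_isHermitian u N α).eigenvalues₀ i) '' A)

/-- The space `V_h(α)` spanned by the snapshots for the parameter `α`. -/
def snapshotSpace (u : (Fin D → ℝ) → ℕ → 𝒯.feSpace m) (N : ℕ) (α : Fin D → ℝ) :
    Submodule ℝ (H10 Ω) :=
  Submodule.span ℝ {v | ∃ k, 1 ≤ k ∧ k ≤ N ∧ v = (u α k : H10 Ω)}

/-- The best constant `c ≥ 0` in `‖v‖₁ ≤ c ‖v‖₀` for `v ∈ W`. -/
def invConst (W : Submodule ℝ (H10 Ω)) : ℝ :=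
  sInf {c | 0 ≤ c ∧ ∀ v ∈ W, ‖v‖ ≤ c * ‖toL2 v‖}

/-- `C_inv`, the supremum over `α ∈ A` of the best inverse inequality constants on
`V_h(α) + Ũ_h`, with `Ũ_h` the finite element counterpart of the universal space. -/
def Cinv {K : Fin D → ℕ} {N : ℕ} (B : NodalBasis 𝒯 m M)
    (u : (Fin D → ℝ) → ℕ → 𝒯.feSpace m) (A : Set (Fin D → ℝ)) (Φ : Tensor M N K) : ℝ :=
  sSup ((fun α => invConst (snapshotSpace u N α ⊔ (fiberSpan Φ).map B.toFE)) '' A)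

/-- The local reduced finite element space, whose coefficient vectors are spanned by the
first `ℓ` columns of `S`. -/
def localSpace (B : NodalBasis 𝒯 m M) (S : Matrix (Fin M) (Fin M) ℝ) (ℓ : ℕ) :
    Submodule ℝ (H10 Ω) :=
  (colSpan S ℓ).map B.toFE

instance (B : NodalBasis 𝒯 m M) (S : Matrix (Fin M) (Fin M) ℝ) (ℓ : ℕ) :
    FiniteDimensional ℝ (localSpace B S ℓ) := by
  unfold localSpace
  infer_instance

end FOM

end LRTD

end

open LRTD

/-! The error `u^j - P_ℓ u^j` lies in `V_h(α) + Ũ_h`: the columns of the interpolated matrix `A =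
contract Φ (χ(α))` are combinations of fibers of `Φ`, so its left singular vectors for nonzero
singular values stay in the fiber span, and the others are chosen there. The inverse inequality
therefore reduces the `H¹` error to the `L²` error at the price of `Cinv ^ 2` (`norm_le_Cinv_mul`),
and in `L²` the projection is at least as good as any other element of the local space, in
particular the columns of the truncated singular value decomposition `W` of `A`.

That decomposition is Euclidean in the nodal coefficients, whereas the eigenvalues of the
correlation matrix are measured in `L²`. The bridge is `exists_mass_equivalence`: on quasi-uniform
meshes the mass matrix is equivalent to `h^d` times the identity, with mesh-independent constants.
It follows from norm equivalence for polynomials on one reference simplex, transported affinely to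
all cells. The factor `h^d` cancels because the equivalence is used once in each direction.

In Euclidean coordinates the tail of the squared singular values of `A` is at most the squared norm
of `A` on any orthonormal family of at least `N - ℓ` vectors (`IsSVD.tail_le`). Taking the trailing
eigenvectors of the correlation matrix and replacing `A` by the true snapshot matrix `U` costs a
multiple of `‖U - A‖²`, and on those eigenvectors `U` has squared `L²` norms `N λ_i`
(`exists_truncation_near`, `norm_snapshots_mul_eigenvector_sq`).

Finally `U - A` splits into the interpolation error of the exact snapshots, of order `δ^p` pointwise
in `x`, and the interpolant of the compression error, of order `ε` by stability of the weights
(`colNormSq_snapshots_sub_le`). -/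

/-! ### Singular value tails and truncation. -/

/-- Threshold argument: replacing `a j` by `a ℓ` in `a j * (w j - 1_{ℓ ≤ j})` can only decrease it,
since the bracket is nonpositive where `a j ≤ a ℓ` and nonnegative where `a j ≥ a ℓ`. The brackets
have nonnegative sum by `hw`. -/
theorem sum_tail_le_sum_mul {N ℓ : ℕ} {a : ℕ → ℝ} (ha : Antitone a)
    (hpos : ∀ i, 0 ≤ a i) {w : Fin N → ℝ} (hw0 : ∀ j, 0 ≤ w j) (hw1 : ∀ j, w j ≤ 1)
    (hw : (N : ℝ) - ℓ ≤ ∑ j, w j) :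
    ∑ j : Fin N with ℓ ≤ j.val, a j ≤ ∑ j : Fin N, a j * w j := by
  have hcard : ∑ j : Fin N, (if ℓ ≤ j.val then (1 : ℝ) else 0) ≤ ∑ j, w j := by
    rcases le_total N ℓ with h | h
    · rw [Finset.sum_eq_zero]
      · exact Finset.sum_nonneg fun j _ => hw0 j
      · intro j _
        rw [if_neg]; have := j.2; omega
    · refine le_trans (le_of_eq ?_) hw
      have : ∑ j : Fin N, (if ℓ ≤ j.val then (1 : ℝ) else 0)
          = ∑ j ∈ Finset.range N, (if ℓ ≤ j then (1 : ℝ) else 0) :=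
        Fin.sum_univ_eq_sum_range (fun j => if ℓ ≤ j then (1 : ℝ) else 0) N
      rw [this, Finset.sum_ite, Finset.sum_const_zero, add_zero, Finset.sum_const, nsmul_one]
      have : (Finset.range N).filter (fun j => ℓ ≤ j) = Finset.Ico ℓ N := by
        ext j; simp; omega
      rw [this, Nat.card_Ico, Nat.cast_sub h]
  rw [Finset.sum_filter]
  have key : ∀ j : Fin N, a ℓ * (w j - if ℓ ≤ j.val then 1 else 0)
      ≤ a j * w j - if ℓ ≤ j.val then a j else 0 := by
    intro j
    split_ifs with h
    · nlinarith [ha h, hw1 j]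
    · nlinarith [ha (not_le.1 h).le, hw0 j]
  have h := Finset.sum_le_sum fun j (_ : j ∈ Finset.univ) => key j
  rw [← Finset.mul_sum, Finset.sum_sub_distrib, Finset.sum_sub_distrib] at h
  nlinarith [hpos ℓ]

theorem sum_sq_orthogonal_mul {M N : ℕ} {S : Matrix (Fin M) (Fin M) ℝ}
    (hS : S ∈ Matrix.orthogonalGroup (Fin M) ℝ) (A : Matrix (Fin M) (Fin N) ℝ) (j : Fin N) :
    ∑ i, (S * A) i j ^ 2 = ∑ i, A i j ^ 2 := by
  have h : (S * A).transpose * (S * A) = A.transpose * A := by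
    rw [Matrix.transpose_mul, Matrix.mul_assoc, ← Matrix.mul_assoc S.transpose]
    rw [Matrix.mem_orthogonalGroup_iff'] at hS
    rw [show S.transpose * S = 1 from hS, Matrix.one_mul]
  have := congrFun (congrFun h j) j
  rw [Matrix.mul_apply, Matrix.mul_apply] at this
  simpa only [Matrix.transpose_apply, sq] using this

theorem sum_sq_mul_orthogonal {M N : ℕ} {E : Matrix (Fin N) (Fin N) ℝ}
    (hE : E ∈ Matrix.orthogonalGroup (Fin N) ℝ) (A : Matrix (Fin M) (Fin N) ℝ) (i : Fin M) :
    ∑ j, (A * E) i j ^ 2 = ∑ j, A i j ^ 2 := by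
  have h : (A * E) * (A * E).transpose = A * A.transpose := by
    rw [Matrix.transpose_mul, Matrix.mul_assoc, ← Matrix.mul_assoc E]
    rw [Matrix.mem_orthogonalGroup_iff] at hE
    rw [show E * E.transpose = 1 from hE, Matrix.one_mul]
  have := congrFun (congrFun h i) i
  rw [Matrix.mul_apply, Matrix.mul_apply] at this
  simpa only [Matrix.transpose_apply, sq] using this

/-- The rectangular diagonal matrix with entries `σ`. -/
def rectDiagonal (M N : ℕ) (σ : ℕ → ℝ) : Matrix (Fin M) (Fin N) ℝ :=
  Matrix.of fun i j => if (i : ℕ) = (j : ℕ) then σ i else 0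

/-- The right side runs over all `N` indices although there are only `M` rows; `hσ` removes the
surplus terms. -/
theorem sum_sq_rectDiagonal_mul {M N k : ℕ} {σ : ℕ → ℝ} (hσ : ∀ i, M ≤ i → σ i = 0)
    (O : Matrix (Fin N) (Fin k) ℝ) (i : Fin k) :
    ∑ r, (rectDiagonal M N σ * O) r i ^ 2 = ∑ j : Fin N, σ j ^ 2 * O j i ^ 2 := by
  have h1 : ∀ r : Fin M, (rectDiagonal M N σ * O) r i ^ 2
      = ∑ j : Fin N, if (r : ℕ) = j then σ j ^ 2 * O j i ^ 2 else 0 := by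
    intro r
    simp only [Matrix.mul_apply, rectDiagonal, Matrix.of_apply, ite_mul, zero_mul]
    by_cases hr : (r : ℕ) < N
    · rw [Finset.sum_eq_single ⟨r, hr⟩, Finset.sum_eq_single ⟨r, hr⟩]
      · simp [mul_pow]
      · intro b _ hb; rw [if_neg]; rintro h; exact hb (Fin.ext h.symm)
      · simp
      · intro b _ hb; rw [if_neg]; rintro h; exact hb (Fin.ext h.symm)
      · simp
    · rw [Finset.sum_eq_zero, Finset.sum_eq_zero]
      · simp
      · intro j _; rw [if_neg]; have := j.2; omega
      · intro j _; rw [if_neg]; have := j.2; omega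
  rw [Finset.sum_congr rfl fun r _ => h1 r, Finset.sum_comm]
  refine Finset.sum_congr rfl fun j _ => ?_
  by_cases hj : (j : ℕ) < M
  · rw [Finset.sum_eq_single ⟨j, hj⟩]
    · simp
    · intro b _ hb; rw [if_neg]; rintro h; exact hb (Fin.ext h)
    · simp
  · rw [hσ j (not_lt.1 hj)]; simp

namespace LRTD.IsSVD

variable {M N : ℕ} {A : Matrix (Fin M) (Fin N) ℝ} {S : Matrix (Fin M) (Fin M) ℝ}
  {σ : ℕ → ℝ} {V : Matrix (Fin N) (Fin N) ℝ}

theorem eq_rectDiagonal (h : IsSVD A S σ V) : A = S * rectDiagonal M N σ * V.transpose :=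
  h.eq_mul

theorem zero_of_rows_le (h : IsSVD A S σ V) (i : ℕ) (hi : M ≤ i) : σ i = 0 :=
  h.zero_of_le i ((min_le_left _ _).trans hi)

/-- The tail of the squared singular values is minimal among the orthonormal families of
at least `N - ℓ` vectors. -/
theorem tail_le (h : IsSVD A S σ V) {E : Matrix (Fin N) (Fin N) ℝ}
    (hE : E ∈ Matrix.orthogonalGroup (Fin N) ℝ) {ℓ : ℕ} (I : Finset (Fin N))
    (hI : N ≤ I.card + ℓ) :
    ∑ j : Fin N with ℓ ≤ j.val, σ j ^ 2 ≤ ∑ i ∈ I, ∑ r, (A * E) r i ^ 2 := by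
  have hO : V.transpose * E ∈ Matrix.orthogonalGroup (Fin N) ℝ :=
    mul_mem (by
      have := Unitary.star_mem h.right_orthogonal
      simpa [Matrix.star_eq_conjTranspose] using this) hE
  set O := V.transpose * E with hOdef
  have hAE : A * E = S * (rectDiagonal M N σ * O) := by
    simp only [h.eq_rectDiagonal, hOdef, Matrix.mul_assoc]
  have e1 : ∀ i, ∑ r, (A * E) r i ^ 2 = ∑ j : Fin N, σ j ^ 2 * O j i ^ 2 := fun i => by
    rw [hAE, sum_sq_orthogonal_mul h.left_orthogonal, sum_sq_rectDiagonal_mul h.zero_of_rows_le]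
  have row : ∀ j, ∑ i, O j i ^ 2 = 1 := fun j => by
    have := sum_sq_mul_orthogonal hO (1 : Matrix (Fin N) (Fin N) ℝ) j
    rw [Matrix.one_mul] at this
    rw [this]; simp [Matrix.one_apply]
  have col : ∀ i, ∑ j, O j i ^ 2 = 1 := fun i => by
    have := sum_sq_orthogonal_mul hO (1 : Matrix (Fin N) (Fin N) ℝ) i
    rw [Matrix.mul_one] at this
    rw [this]; simp [Matrix.one_apply]
  rw [Finset.sum_congr rfl fun i _ => e1 i, Finset.sum_comm]
  simp_rw [← Finset.mul_sum]
  -- The squared entries of the orthogonal `O` are doubly stochastic, so the weights `∑ i ∈ I, O j i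
  -- ^ 2` are at most 1 and add up to `I.card ≥ N - ℓ`.
  refine sum_tail_le_sum_mul (a := fun j => σ j ^ 2) (w := fun j => ∑ i ∈ I, O j i ^ 2)
    (fun i j hij => pow_le_pow_left₀ (h.nonneg j) (h.antitone hij) 2) (fun i => sq_nonneg _)
    (fun j => Finset.sum_nonneg fun i _ => sq_nonneg _) (fun j => ?_) ?_
  · rw [← row j]
    exact Finset.sum_le_sum_of_subset_of_nonneg (Finset.subset_univ _) fun i _ _ => sq_nonneg _
  · rw [Finset.sum_comm, Finset.sum_congr rfl fun i _ => col i]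
    have : (N : ℝ) ≤ I.card + ℓ := by exact_mod_cast hI
    simp; linarith

/-- The truncated singular value decomposition. -/
theorem exists_truncation (h : IsSVD A S σ V) (ℓ : ℕ) :
    ∃ W : Matrix (Fin M) (Fin N) ℝ, (∀ j, (fun i => W i j) ∈ colSpan S ℓ) ∧
      ∑ j, ∑ i, (A - W) i j ^ 2 = ∑ j : Fin N with ℓ ≤ j.val, σ j ^ 2 := by
  let τ : ℕ → ℝ := fun i => if i < ℓ then σ i else 0
  refine ⟨S * (rectDiagonal M N τ * V.transpose), fun j => ?_, ?_⟩
  · have : (fun i => (S * (rectDiagonal M N τ * V.transpose)) i j)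
        = ∑ r : Fin M, (rectDiagonal M N τ * V.transpose) r j • fun k => S k r := by
      ext i
      simp [Matrix.mul_apply, mul_comm]
    rw [this]
    refine Submodule.sum_mem _ fun r _ => ?_
    by_cases hr : (r : ℕ) < ℓ
    · exact Submodule.smul_mem _ _ (Submodule.subset_span ⟨r, hr, rfl⟩)
    · have : (rectDiagonal M N τ * V.transpose) r j = 0 := by
        rw [Matrix.mul_apply]
        refine Finset.sum_eq_zero fun k _ => ?_
        simp [rectDiagonal, τ, hr]
      rw [this, zero_smul]
      exact Submodule.zero_mem _
  · have hd : A - S * (rectDiagonal M N τ * V.transpose)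
        = S * (rectDiagonal M N (fun i => if i < ℓ then 0 else σ i) * V.transpose) := by
      rw [h.eq_rectDiagonal, Matrix.mul_assoc, ← Matrix.mul_sub, ← Matrix.sub_mul]
      congr 2
      ext i j
      simp only [Matrix.sub_apply, rectDiagonal, Matrix.of_apply, τ]
      split_ifs <;> simp
    have hz : ∀ i, M ≤ i → (fun i => if i < ℓ then 0 else σ i) i = 0 := fun i hi => by
      simp [h.zero_of_rows_le i hi]
    have hV : V.transpose ∈ Matrix.orthogonalGroup (Fin N) ℝ := by
      have := Unitary.star_mem h.right_orthogonal
      simpa [Matrix.star_eq_conjTranspose] using this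
    rw [hd]
    simp_rw [sum_sq_orthogonal_mul h.left_orthogonal, sum_sq_rectDiagonal_mul hz]
    rw [Finset.sum_comm]
    simp_rw [← Finset.mul_sum]
    rw [Finset.sum_filter]
    refine Finset.sum_congr rfl fun j _ => ?_
    have row : ∑ i, V.transpose j i ^ 2 = 1 := by
      have := sum_sq_mul_orthogonal hV (1 : Matrix (Fin N) (Fin N) ℝ) j
      rw [Matrix.one_mul] at this
      rw [this]; simp [Matrix.one_apply]
    rw [row]
    split_ifs <;> first | omega | simp

/-- Left singular vectors for nonzero singular values lie in every subspace that contains the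
columns of the matrix. -/
theorem colSpan_le (h : IsSVD A S σ V) {ℓ : ℕ} {P : Submodule ℝ (Fin M → ℝ)}
    (hA : ∀ j, (fun i => A i j) ∈ P)
    (h0 : ∀ i : Fin M, (i : ℕ) < ℓ → σ i = 0 → (fun k => S k i) ∈ P) : colSpan S ℓ ≤ P := by
  refine Submodule.span_le.2 ?_
  rintro _ ⟨i, hi, rfl⟩
  by_cases hσ : σ i = 0
  · exact h0 i hi hσ
  have hiN : (i : ℕ) < N := by
    by_contra hc
    exact hσ (h.zero_of_le i ((min_le_right _ _).trans (not_lt.1 hc)))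
  have hAV : A * V = S * rectDiagonal M N σ := by
    rw [h.eq_rectDiagonal, Matrix.mul_assoc]
    have := h.right_orthogonal
    rw [Matrix.mem_orthogonalGroup_iff'] at this
    rw [show V.transpose * V = 1 from this, Matrix.mul_one]
  -- Column `i` of `A V = S Σ`, divided by `σ i`; the nonzero value forces `i < N`, so that `V` has
  -- such a column.
  have hcol : (fun k => S k i) = (σ i)⁻¹ • ∑ j, V j ⟨i, hiN⟩ • fun k => A k j := by
    ext k
    have := congrFun (congrFun hAV k) ⟨i, hiN⟩
    rw [Matrix.mul_apply, Matrix.mul_apply, Finset.sum_eq_single i] at this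
    · simp only [rectDiagonal, Matrix.of_apply, if_true] at this
      simp only [Pi.smul_apply, Finset.sum_apply, smul_eq_mul]
      rw [Finset.sum_congr rfl fun j _ => mul_comm (V j _) (A k j), this]
      field_simp
    · intro b _ hb
      simp only [rectDiagonal, Matrix.of_apply]
      rw [if_neg (fun hh => hb (Fin.ext hh)), mul_zero]
    · simp
  rw [SetLike.mem_coe, hcol]
  exact P.smul_mem _ (P.sum_mem fun j _ => P.smul_mem _ (hA j))

end LRTD.IsSVD

/-! ### Unisolvence and norm equivalence on the reference simplex. -/

/-- The multi-indices of the monomials of degree at most `m` in `d` variables. -/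
abbrev LatticeIndex (d m : ℕ) := ↥{n : Fin d →₀ ℕ | (n.sum fun _ e => e) ≤ m}

instance (d m : ℕ) : Finite (LatticeIndex d m) := by
  rw [Set.finite_coe_iff]
  exact Finsupp.finite_of_degree_le m

noncomputable instance (d m : ℕ) : Fintype (LatticeIndex d m) := Fintype.ofFinite _

/-- The lattice points of the reference simplex. -/
noncomputable def latticePoint {d m : ℕ} (k : LatticeIndex d m) : Space d :=
  WithLp.toLp 2 fun i => (k.1 i : ℝ) / m

/-- The value of a polynomial at a point. -/
noncomputable abbrev polyEval {d : ℕ} (x : Space d) (q : MvPolynomial (Fin d) ℝ) : ℝ :=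
  MvPolynomial.eval (fun i => x i) q

theorem continuous_polyEval {d : ℕ} (q : MvPolynomial (Fin d) ℝ) :
    Continuous fun x : Space d => polyEval x q :=
  (MvPolynomial.continuous_eval q).comp (by fun_prop)

theorem LatticeIndex.sum_le {d m : ℕ} (k : LatticeIndex d m) : ∑ i, k.1 i ≤ m := by
  rw [← Finsupp.degree_eq_sum]; exact k.2

theorem totalDegree_C_mul_X_sub_C_le {σ : Type*} (a b : ℝ) (i : σ) :
    (MvPolynomial.C a * MvPolynomial.X i - MvPolynomial.C b : MvPolynomial σ ℝ).totalDegree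
      ≤ 1 := by
  refine (MvPolynomial.totalDegree_sub _ _).trans (max_le ?_ (by simp))
  refine (MvPolynomial.totalDegree_mul _ _).trans (by simp)

/-- The Lagrange polynomials of the principal lattice. -/
theorem exists_lagrange {d m : ℕ} (hm : 1 ≤ m) (k : LatticeIndex d m) :
    ∃ q : MvPolynomial (Fin d) ℝ, q.totalDegree ≤ m ∧ polyEval (latticePoint k) q ≠ 0 ∧
      ∀ k' : LatticeIndex d m, k' ≠ k → polyEval (latticePoint k') q = 0 := by
  have hm0 : (m : ℝ) ≠ 0 := by positivity
  -- The barycentric index of `k` at the vertex `0`. `P` carries the linear factors of the `d`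
  -- coordinates, `Q` those of this last one; the degrees add up to `m`.
  set r := m - ∑ i, k.1 i with hr
  let P : MvPolynomial (Fin d) ℝ := ∏ i, ∏ j ∈ Finset.range (k.1 i),
    (MvPolynomial.C (m : ℝ) * MvPolynomial.X i - MvPolynomial.C (j : ℝ))
  let Q : MvPolynomial (Fin d) ℝ := ∏ j ∈ Finset.range r,
    (MvPolynomial.C ((m : ℝ) - j) - ∑ i, MvPolynomial.C (m : ℝ) * MvPolynomial.X i)
  have evP : ∀ k' : LatticeIndex d m, polyEval (latticePoint k') P
      = ∏ i, ∏ j ∈ Finset.range (k.1 i), ((k'.1 i : ℝ) - j) := by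
    intro k'
    simp only [polyEval, P, map_prod, map_sub, map_mul, MvPolynomial.eval_C, MvPolynomial.eval_X,
      latticePoint]
    refine Finset.prod_congr rfl fun i _ => Finset.prod_congr rfl fun j _ => ?_
    field_simp
  have evQ : ∀ k' : LatticeIndex d m, polyEval (latticePoint k') Q
      = ∏ j ∈ Finset.range r, (((m - ∑ i, k'.1 i : ℕ) : ℝ) - j) := by
    intro k'
    simp only [polyEval, Q, map_prod, map_sub, map_mul, map_sum, MvPolynomial.eval_C,
      MvPolynomial.eval_X, latticePoint]
    refine Finset.prod_congr rfl fun j _ => ?_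
    rw [Nat.cast_sub k'.sum_le, Nat.cast_sum]
    have : ∑ x, (m : ℝ) * ((k'.1 x : ℝ) / m) = ∑ x, (k'.1 x : ℝ) :=
      Finset.sum_congr rfl fun x _ => by field_simp
    rw [this]; ring
  refine ⟨P * Q, ?_, ?_, ?_⟩
  · refine (MvPolynomial.totalDegree_mul _ _).trans ?_
    have h1 : P.totalDegree ≤ ∑ i, k.1 i := by
      refine (MvPolynomial.totalDegree_finsetProd _ _).trans (Finset.sum_le_sum fun i _ => ?_)
      refine (MvPolynomial.totalDegree_finsetProd _ _).trans ?_
      refine (Finset.sum_le_sum fun j _ => totalDegree_C_mul_X_sub_C_le _ _ _).trans ?_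
      simp
    have h2 : Q.totalDegree ≤ r := by
      refine (MvPolynomial.totalDegree_finsetProd _ _).trans ?_
      refine (Finset.sum_le_sum (g := fun _ => 1) fun j _ => ?_).trans (by simp)
      refine (MvPolynomial.totalDegree_sub _ _).trans
        (max_le (by rw [MvPolynomial.totalDegree_C]; exact zero_le_one) ?_)
      refine MvPolynomial.totalDegree_finsetSum_le fun i _ => ?_
      exact (MvPolynomial.totalDegree_mul _ _).trans (by
        rw [MvPolynomial.totalDegree_C, MvPolynomial.totalDegree_X])
    have := k.sum_le
    omega
  · rw [polyEval, map_mul]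
    refine mul_ne_zero ?_ ?_
    · rw [← polyEval, evP]
      refine Finset.prod_ne_zero_iff.2 fun i _ => Finset.prod_ne_zero_iff.2 fun j hj => ?_
      have := Finset.mem_range.1 hj
      exact sub_ne_zero.2 (by exact_mod_cast this.ne')
    · rw [← polyEval, evQ]
      refine Finset.prod_ne_zero_iff.2 fun j hj => ?_
      have := Finset.mem_range.1 hj
      exact sub_ne_zero.2 (by exact_mod_cast this.ne')
  · intro k' hk'
    rw [polyEval, map_mul]
    -- Barycentric indices sum to `m`, so if `k' ≠ k` one of the `d + 1` indices of `k'` is smaller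
    -- than that of `k`, and a factor of `P` or of `Q` vanishes.
    by_cases h : ∃ i, k'.1 i < k.1 i
    · obtain ⟨i, hi⟩ := h
      rw [← polyEval, evP, Finset.prod_eq_zero (Finset.mem_univ i), zero_mul]
      exact Finset.prod_eq_zero (Finset.mem_range.2 hi) (sub_self _)
    · push Not at h
      have hlt : ∑ i, k.1 i < ∑ i, k'.1 i := by
        refine Finset.sum_lt_sum (fun i _ => h i) ?_
        by_contra hc
        push Not at hc
        refine hk' (Subtype.ext (Finsupp.ext fun i => le_antisymm (hc i (Finset.mem_univ i)) (h i)))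
      have h3 : m - ∑ i, k'.1 i < r := by have := k'.sum_le; omega
      rw [← polyEval, ← polyEval, evQ, Finset.prod_eq_zero (Finset.mem_range.2 h3) (sub_self _),
        mul_zero]

/-- The values of polynomials of degree at most `m` at the lattice points. -/
noncomputable def nodalValues (d m : ℕ) :
    MvPolynomial.restrictTotalDegree (Fin d) ℝ m →ₗ[ℝ] (LatticeIndex d m → ℝ) where
  toFun q k := polyEval (latticePoint k) q.1
  map_add' p q := by ext k; simp [polyEval]
  map_smul' c q := by ext k; simp [polyEval, MvPolynomial.smul_eval]

/-- Unisolvence of the principal lattice. -/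
theorem nodalValues_injective {d m : ℕ} (hm : 1 ≤ m) :
    Function.Injective (nodalValues d m) := by
  classical
  -- Monomials and nodes share one index set, so injectivity is equivalent to surjectivity, which
  -- the Lagrange polynomials provide.
  have hfr : Module.finrank ℝ (MvPolynomial.restrictTotalDegree (Fin d) ℝ m)
      = Module.finrank ℝ (LatticeIndex d m → ℝ) := by
    rw [Module.finrank_fintype_fun_eq_card]
    exact Module.finrank_eq_card_basis
      (MvPolynomial.basisRestrictSupport ℝ {n : Fin d →₀ ℕ | (n.sum fun _ e => e) ≤ m})
  rw [LinearMap.injective_iff_surjective_of_finrank_eq_finrank hfr, ← LinearMap.range_eq_top,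
    eq_top_iff, ← (Pi.basisFun ℝ (LatticeIndex d m)).span_eq, Submodule.span_le]
  rintro _ ⟨k, rfl⟩
  obtain ⟨q, hq, h1, h0⟩ := exists_lagrange hm k
  refine ⟨(polyEval (latticePoint k) q)⁻¹ •
    ⟨q, (MvPolynomial.mem_restrictTotalDegree _ _ _).2 hq⟩, ?_⟩
  ext k'
  rw [map_smul, Pi.basisFun_apply]
  simp only [nodalValues, LinearMap.coe_mk, AddHom.coe_mk, Pi.smul_apply, smul_eq_mul]
  by_cases hk : k' = k
  · subst hk; simp [h1]
  · simp [h0 k' hk, Pi.single_eq_of_ne hk]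

/-- `B` factors through the finite-dimensional range of `A`, where every linear map is continuous;
`C` is its operator norm. -/
theorem LinearMap.exists_norm_le_of_injective {E F G : Type*} [AddCommGroup E] [Module ℝ E]
    [FiniteDimensional ℝ E] [NormedAddCommGroup F] [NormedSpace ℝ F] [NormedAddCommGroup G]
    [NormedSpace ℝ G] (A : E →ₗ[ℝ] F) (hA : Function.Injective A) (B : E →ₗ[ℝ] G) :
    ∃ C : ℝ, 0 ≤ C ∧ ∀ q, ‖B q‖ ≤ C * ‖A q‖ := by
  let e := LinearEquiv.ofInjective A hA
  let T : LinearMap.range A →L[ℝ] G := (B.comp e.symm.toLinearMap).toContinuousLinearMap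
  refine ⟨‖T‖, T.opNorm_nonneg, fun q => ?_⟩
  have h := T.le_opNorm (e q)
  have h1 : T (e q) = B q := by simp [T]
  have h2 : ‖e q‖ = ‖A q‖ := rfl
  rwa [h1, h2] at h

/-- The vertices of the reference simplex. -/
noncomputable def refVertex (d : ℕ) : Fin (d + 1) → Space d :=
  Fin.cons 0 fun i => EuclideanSpace.single i 1

/-- The reference simplex. -/
def refSimplex (d : ℕ) : Set (Space d) := convexHull ℝ (Set.range (refVertex d))

theorem isCompact_refSimplex (d : ℕ) : IsCompact (refSimplex d) :=
  (Set.finite_range (refVertex d)).isCompact_convexHull ℝ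

theorem affineIndependent_refVertex (d : ℕ) : AffineIndependent ℝ (refVertex d) := by
  rw [affineIndependent_iff_linearIndependent_vsub ℝ _ (0 : Fin (d + 1))]
  have h : LinearIndependent ℝ fun i : Fin d => EuclideanSpace.single i (1 : ℝ) := by
    have := (EuclideanSpace.basisFun (Fin d) ℝ).toBasis.linearIndependent
    have hb : (fun i : Fin d => EuclideanSpace.single i (1 : ℝ))
        = ⇑(EuclideanSpace.basisFun (Fin d) ℝ).toBasis := by funext i; simp
    rw [hb]; exact this
  rw [← linearIndependent_equiv (finSuccAboveEquiv (0 : Fin (d + 1)))]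
  have he : ((fun i : { x // x ≠ (0 : Fin (d + 1)) } => refVertex d i -ᵥ refVertex d 0) ∘
      finSuccAboveEquiv (0 : Fin (d + 1))) = fun i : Fin d => EuclideanSpace.single i (1 : ℝ) := by
    funext i
    simp only [Function.comp_apply, finSuccAboveEquiv_apply, Fin.succAbove_zero, refVertex,
      Fin.cons_succ, Fin.cons_zero, vsub_eq_sub, sub_zero]
  rw [he]
  exact h

theorem interior_refSimplex_nonempty (d : ℕ) : (interior (refSimplex d)).Nonempty := by
  rw [refSimplex, interior_convexHull_nonempty_iff_affineSpan_eq_top,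
    (affineIndependent_refVertex d).affineSpan_eq_top_iff_card_eq_finrank_add_one]
  simp

theorem latticePoint_mem_refSimplex {d m : ℕ} (hm : 1 ≤ m) (k : LatticeIndex d m) :
    latticePoint k ∈ refSimplex d := by
  have hm0 : (0 : ℝ) < m := by positivity
  have hk : (∑ i, (k.1 i : ℝ)) ≤ m := by exact_mod_cast k.sum_le
  have h := (convex_convexHull ℝ (Set.range (refVertex d))).sum_mem (t := Finset.univ)
    (w := Fin.cons (1 - ∑ i, (k.1 i : ℝ) / m) fun i => (k.1 i : ℝ) / m) (z := refVertex d)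
    (fun i _ => by
      refine Fin.cases ?_ (fun i => ?_) i
      · simp only [Fin.cons_zero]
        rw [← Finset.sum_div, sub_nonneg, div_le_one hm0]
        exact hk
      · simp only [Fin.cons_succ]; positivity)
    (by rw [Fin.sum_univ_succ]; simp)
    (fun i _ => subset_convexHull ℝ _ ⟨i, rfl⟩)
  rw [refSimplex]
  convert h using 1
  rw [Fin.sum_univ_succ]
  ext i
  simp [refVertex, latticePoint, Finset.sum_apply, Pi.single_apply]

theorem sq_sum_eq_norm_sq {ι : Type*} [Fintype ι] (f : ι → ℝ) :
    ∑ i, f i ^ 2 = ‖WithLp.toLp 2 f‖ ^ 2 := by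
  rw [EuclideanSpace.norm_sq_eq]; simp

/-- Continuous functions equal almost everywhere agree on a set contained in the closure of its
interior, as a convex set with nonempty interior is. -/
theorem polyEval_eq_of_ae_eq {d : ℕ} {s : Set (Space d)} (hs : Convex ℝ s)
    (hi : (interior s).Nonempty) {q r : MvPolynomial (Fin d) ℝ}
    (h : (fun x => polyEval x q) =ᵐ[volume.restrict s] fun x => polyEval x r) :
    ∀ x ∈ s, polyEval x q = polyEval x r :=
  Measure.eqOn_of_ae_eq h (continuous_polyEval q).continuousOn (continuous_polyEval r).continuousOn
    (by rw [hs.closure_interior_eq_closure_of_nonempty_interior hi]; exact subset_closure)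

theorem memLp_polyEval {d : ℕ} {s : Set (Space d)} (hs : IsCompact s)
    (q : MvPolynomial (Fin d) ℝ) :
    MemLp (fun x => polyEval x q) 2 (volume.restrict s) := by
  have : IsFiniteMeasure (volume.restrict s) := ⟨by simpa using hs.measure_lt_top⟩
  obtain ⟨C, hC⟩ := hs.exists_bound_of_continuousOn (continuous_polyEval q).continuousOn
  refine MemLp.of_bound (continuous_polyEval q).aestronglyMeasurable C ?_
  exact (ae_restrict_iff' hs.measurableSet).2 (Filter.Eventually.of_forall hC)

/-- The class in `L²` of the reference simplex of a polynomial. -/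
noncomputable def polyToLp (d m : ℕ) : MvPolynomial.restrictTotalDegree (Fin d) ℝ m →ₗ[ℝ]
    Lp ℝ 2 (volume.restrict (refSimplex d)) where
  toFun q := (memLp_polyEval (isCompact_refSimplex d) q.1).toLp _
  map_add' p q := by
    rw [← MemLp.toLp_add]
    congr 1; ext x; simp [polyEval]
  map_smul' c q := by
    rw [RingHom.id_apply, ← MemLp.toLp_const_smul]
    congr 1; ext x; simp [polyEval, MvPolynomial.smul_eval]

theorem Lp_norm_sq_eq_integral {α : Type*} [MeasurableSpace α] {μ : Measure α} (f : Lp ℝ 2 μ) :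
    ‖f‖ ^ 2 = ∫ x, f x ^ 2 ∂μ := by
  rw [← real_inner_self_eq_norm_sq, L2.inner_def]
  refine integral_congr_ae (Filter.Eventually.of_forall fun x => ?_)
  simp [sq]

theorem norm_polyToLp_sq {d m : ℕ} (q : MvPolynomial.restrictTotalDegree (Fin d) ℝ m) :
    ‖polyToLp d m q‖ ^ 2 = ∫ x in refSimplex d, polyEval x q.1 ^ 2 := by
  rw [Lp_norm_sq_eq_integral]
  refine integral_congr_ae ?_
  filter_upwards [(memLp_polyEval (isCompact_refSimplex d) q.1).coeFn_toLp] with x hx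
  exact congrArg (· ^ 2) hx

/-- A polynomial vanishing almost everywhere on the simplex vanishes at the lattice points, so
unisolvence applies. -/
theorem polyToLp_injective {d m : ℕ} (hm : 1 ≤ m) : Function.Injective (polyToLp d m) := by
  rw [injective_iff_map_eq_zero]
  intro q hq
  have h0 : (fun x => polyEval x q.1) =ᵐ[volume.restrict (refSimplex d)]
      fun x => polyEval x (0 : MvPolynomial (Fin d) ℝ) := by
    have h1 := (memLp_polyEval (isCompact_refSimplex d) q.1).coeFn_toLp
    have h2 : (memLp_polyEval (isCompact_refSimplex d) q.1).toLp _ = 0 := hq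
    rw [h2] at h1
    filter_upwards [h1, Lp.coeFn_zero ℝ 2 (volume.restrict (refSimplex d))] with x hx hx0
    rw [← hx, hx0]; simp [polyEval]
  have h1 := polyEval_eq_of_ae_eq (convex_convexHull ℝ _) (interior_refSimplex_nonempty d) h0
  refine nodalValues_injective hm ?_
  rw [map_zero]
  ext k
  have := h1 _ (latticePoint_mem_refSimplex hm k)
  simp only [polyEval, map_zero] at this
  exact this

/-- Equivalence of norms for polynomials of degree at most `m` on the reference simplex. -/
theorem exists_reference_bounds (d : ℕ) {m : ℕ} (hm : 1 ≤ m) :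
    ∃ C : ℝ, 0 < C ∧ ∀ q : MvPolynomial (Fin d) ℝ, q.totalDegree ≤ m →
      (∀ x ∈ refSimplex d, polyEval x q ^ 2 ≤ C * ∑ k : LatticeIndex d m,
        polyEval (latticePoint k) q ^ 2) ∧
      ∀ k : LatticeIndex d m, polyEval (latticePoint k) q ^ 2
        ≤ C * ∫ x in refSimplex d, polyEval x q ^ 2 := by
  have : CompactSpace (refSimplex d) := isCompact_iff_compactSpace.1 (isCompact_refSimplex d)
  let A : MvPolynomial.restrictTotalDegree (Fin d) ℝ m →ₗ[ℝ]
      EuclideanSpace ℝ (LatticeIndex d m) :=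
    (WithLp.linearEquiv 2 ℝ (LatticeIndex d m → ℝ)).symm.toLinearMap.comp (nodalValues d m)
  have hA : Function.Injective A :=
    (WithLp.linearEquiv 2 ℝ (LatticeIndex d m → ℝ)).symm.injective.comp
      (nodalValues_injective hm)
  let S : MvPolynomial.restrictTotalDegree (Fin d) ℝ m →ₗ[ℝ] C(refSimplex d, ℝ) :=
    { toFun := fun q => ⟨fun x => polyEval x.1 q.1,
        (continuous_polyEval q.1).comp continuous_subtype_val⟩
      map_add' := fun p q => by ext x; simp [polyEval]
      map_smul' := fun c q => by ext x; simp [polyEval, MvPolynomial.smul_eval] }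
  -- Nodal values control the sup norm because they are unisolvent; the `L²` norm controls nodal
  -- values because it is a norm on polynomials.
  obtain ⟨C₁, hC₁, h₁⟩ := A.exists_norm_le_of_injective hA S
  obtain ⟨C₂, hC₂, h₂⟩ := (polyToLp d m).exists_norm_le_of_injective (polyToLp_injective hm) A
  have nA : ∀ q, ‖A q‖ ^ 2 = ∑ k : LatticeIndex d m, polyEval (latticePoint k) q.1 ^ 2 :=
    fun q => (sq_sum_eq_norm_sq _).symm
  refine ⟨C₁ ^ 2 + C₂ ^ 2 + 1, by positivity, fun q hq => ?_⟩
  let q' : MvPolynomial.restrictTotalDegree (Fin d) ℝ m :=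
    ⟨q, (MvPolynomial.mem_restrictTotalDegree _ _ _).2 hq⟩
  constructor
  · intro x hx
    have h3 : |polyEval x q| ≤ C₁ * ‖A q'‖ :=
      ((S q').norm_coe_le_norm ⟨x, hx⟩).trans (h₁ q')
    have h4 : polyEval x q ^ 2 ≤ C₁ ^ 2 * ‖A q'‖ ^ 2 := by
      rw [← mul_pow, ← sq_abs]; exact pow_le_pow_left₀ (abs_nonneg _) h3 2
    rw [nA] at h4
    refine h4.trans (mul_le_mul_of_nonneg_right ?_ (Finset.sum_nonneg fun _ _ => sq_nonneg _))
    nlinarith [sq_nonneg C₂]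
  · intro k
    have h3 : ‖A q'‖ ^ 2 ≤ C₂ ^ 2 * ‖polyToLp d m q'‖ ^ 2 := by
      rw [← mul_pow]; exact pow_le_pow_left₀ (norm_nonneg _) (h₂ q') 2
    rw [nA, norm_polyToLp_sq] at h3
    have h4 : polyEval (latticePoint k) q ^ 2
        ≤ ∑ k : LatticeIndex d m, polyEval (latticePoint k) q ^ 2 :=
      Finset.single_le_sum (f := fun k : LatticeIndex d m => polyEval (latticePoint k) q ^ 2)
        (fun _ _ => sq_nonneg _) (Finset.mem_univ k)
    refine (h4.trans h3).trans (mul_le_mul_of_nonneg_right ?_ (integral_nonneg fun _ => sq_nonneg _))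
    nlinarith [sq_nonneg C₁]

/-! ### Affine transport to an arbitrary simplex. -/

/-- The linear part of the affine map from the reference simplex to the simplex with vertices
`v`. -/
noncomputable def simplexLinear {d : ℕ} (v : Fin (d + 1) → Space d) : Space d →L[ℝ] Space d :=
  ((Fintype.linearCombination ℝ fun i : Fin d => v i.succ - v 0).comp
    (WithLp.linearEquiv 2 ℝ (Fin d → ℝ)).toLinearMap).toContinuousLinearMap

theorem simplexLinear_apply {d : ℕ} (v : Fin (d + 1) → Space d) (x : Space d) :
    simplexLinear v x = ∑ i : Fin d, x i • (v i.succ - v 0) := by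
  simp [simplexLinear, Fintype.linearCombination_apply]

/-- The affine map from the reference simplex to the simplex with vertices `v`. -/
noncomputable def simplexMap {d : ℕ} (v : Fin (d + 1) → Space d) : Space d →ᵃ[ℝ] Space d :=
  (simplexLinear v).toLinearMap.toAffineMap + AffineMap.const ℝ _ (v 0)

theorem simplexMap_apply {d : ℕ} (v : Fin (d + 1) → Space d) (x : Space d) :
    simplexMap v x = simplexLinear v x + v 0 := rfl

theorem simplexMap_refVertex {d : ℕ} (v : Fin (d + 1) → Space d) (i : Fin (d + 1)) :
    simplexMap v (refVertex d i) = v i := by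
  rw [simplexMap_apply, simplexLinear_apply]
  refine Fin.cases ?_ (fun i => ?_) i
  · simp [refVertex]
  · simp [refVertex]

theorem image_refSimplex {d : ℕ} (v : Fin (d + 1) → Space d) :
    simplexMap v '' refSimplex d = convexHull ℝ (Set.range v) := by
  rw [refSimplex, AffineMap.image_convexHull, ← Set.range_comp]
  congr 2
  ext1 i
  exact simplexMap_refVertex v i

theorem simplexMap_injective {d : ℕ} {v : Fin (d + 1) → Space d} (hv : AffineIndependent ℝ v) :
    Function.Injective (simplexMap v) := by
  have hli : LinearIndependent ℝ fun i : Fin d => v i.succ - v 0 := by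
    rw [affineIndependent_iff_linearIndependent_vsub ℝ _ (0 : Fin (d + 1)),
      ← linearIndependent_equiv (finSuccAboveEquiv (0 : Fin (d + 1)))] at hv
    have he : ((fun i : { x // x ≠ (0 : Fin (d + 1)) } => v i -ᵥ v 0) ∘
        finSuccAboveEquiv (0 : Fin (d + 1))) = fun i : Fin d => v i.succ - v 0 := by
      funext i
      simp only [Function.comp_apply, finSuccAboveEquiv_apply, Fin.succAbove_zero, vsub_eq_sub]
    rwa [he] at hv
  have h : Function.Injective (simplexLinear v) := by
    rw [injective_iff_map_eq_zero]
    intro x hx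
    rw [simplexLinear_apply] at hx
    ext i
    exact Fintype.linearIndependent_iff.1 hli _ hx i
  intro x y hxy
  rw [simplexMap_apply, simplexMap_apply] at hxy
  exact h (add_right_cancel hxy)

/-- The change of variables to the reference simplex. -/
theorem setIntegral_simplex {d : ℕ} {v : Fin (d + 1) → Space d} (hv : AffineIndependent ℝ v)
    (g : Space d → ℝ) :
    ∫ x in convexHull ℝ (Set.range v), g x
      = |(simplexLinear v).det| * ∫ x in refSimplex d, g (simplexMap v x) := by
  rw [← image_refSimplex, integral_image_eq_integral_abs_det_fderiv_smul volume
    (isCompact_refSimplex d).measurableSet (f := simplexMap v)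
    (f' := fun _ => simplexLinear v)
    (fun x _ => ((simplexLinear v).hasFDerivAt.add_const (v 0)).hasFDerivWithinAt)
    (simplexMap_injective hv).injOn g, ← integral_const_mul]
  rfl

/-- Substituting forms of degree at most one for the variables does not raise the degree. -/
theorem exists_pullback {d : ℕ} (v : Fin (d + 1) → Space d) (q : MvPolynomial (Fin d) ℝ) :
    ∃ r : MvPolynomial (Fin d) ℝ, r.totalDegree ≤ q.totalDegree ∧
      ∀ x, polyEval x r = polyEval (simplexMap v x) q := by
  let l : Fin d → MvPolynomial (Fin d) ℝ := fun j => MvPolynomial.C (v 0 j) +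
    ∑ i : Fin d, MvPolynomial.C ((v i.succ - v 0) j) * MvPolynomial.X i
  have hl : ∀ j, (l j).totalDegree ≤ 1 := fun j => by
    refine (MvPolynomial.totalDegree_add _ _).trans
      (max_le (by rw [MvPolynomial.totalDegree_C]; exact zero_le_one) ?_)
    refine MvPolynomial.totalDegree_finsetSum_le fun i _ => ?_
    exact (MvPolynomial.totalDegree_mul _ _).trans (by
      rw [MvPolynomial.totalDegree_C, MvPolynomial.totalDegree_X])
  refine ⟨MvPolynomial.bind₁ l q, ?_, fun x => ?_⟩
  · rw [MvPolynomial.bind₁, MvPolynomial.aeval_def, MvPolynomial.eval₂_eq']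
    refine MvPolynomial.totalDegree_finsetSum_le fun n hn => ?_
    refine (MvPolynomial.totalDegree_mul _ _).trans ?_
    rw [MvPolynomial.algebraMap_eq, MvPolynomial.totalDegree_C, zero_add]
    refine (MvPolynomial.totalDegree_finsetProd _ _).trans ?_
    refine le_trans ?_ (MvPolynomial.le_totalDegree hn)
    rw [Finsupp.sum_fintype _ _ (fun _ => rfl)]
    refine Finset.sum_le_sum fun i _ => (MvPolynomial.totalDegree_pow _ _).trans ?_
    exact (Nat.mul_le_mul_left _ (hl i)).trans (by simp)
  · rw [polyEval, polyEval, MvPolynomial.eval, MvPolynomial.eval₂Hom_bind₁]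
    congr 2
    ext j
    rw [simplexMap_apply, simplexLinear_apply]
    simp only [l, map_add, map_sum, map_mul, MvPolynomial.eval₂Hom_C,
      MvPolynomial.eval₂Hom_X', RingHom.id_apply, PiLp.add_apply, WithLp.ofLp_sum, Finset.sum_apply, PiLp.smul_apply, smul_eq_mul]
    rw [add_comm]
    congr 1
    exact Finset.sum_congr rfl fun i _ => mul_comm _ _

/-- Affine maps preserve barycentric coordinates; a `LatticeIndex` omits the weight of `v 0`, which
is recovered as `m` minus the sum of the others. -/
theorem mem_latticePoints_iff {d m : ℕ} (hm : 1 ≤ m) {s : Finset (Space d)}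
    {v : Fin (d + 1) → Space d} (hv : Function.Injective v) (hs : (s : Set (Space d)) = Set.range v)
    (y : Space d) :
    y ∈ Triangulation.latticePoints m s ↔
      ∃ k : LatticeIndex d m, y = simplexMap v (latticePoint k) := by
  classical
  have hm0 : (m : ℝ) ≠ 0 := by positivity
  have hs' : s = Finset.univ.image v := by
    rw [← Finset.coe_inj, hs]; simp
  have sum_eq : ∀ {G : Type} [AddCommMonoid G] (g : Space d → G),
      ∑ x ∈ s, g x = g (v 0) + ∑ i : Fin d, g (v i.succ) := by
    intro G _ g
    rw [hs', Finset.sum_image fun a _ b _ h => hv h, Fin.sum_univ_succ]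
  have key : ∀ (k : Space d → ℕ) (n : LatticeIndex d m), (∀ i, n.1 i = k (v i.succ)) →
      k (v 0) + ∑ i : Fin d, k (v i.succ) = m →
      ∑ x ∈ s, ((k x : ℝ) / m) • x = simplexMap v (latticePoint n) := by
    intro k n hn hk
    have hk' : (k (v 0) : ℝ) / m = 1 - ∑ i : Fin d, (k (v i.succ) : ℝ) / m := by
      rw [← Finset.sum_div, eq_sub_iff_add_eq, ← add_div, div_eq_one_iff_eq hm0]
      exact_mod_cast hk
    rw [sum_eq, hk', simplexMap_apply, simplexLinear_apply]
    simp only [latticePoint, hn, smul_sub, Finset.sum_sub_distrib, ← Finset.sum_smul, sub_smul,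
      one_smul]
    abel
  constructor
  · rintro ⟨k, hk, rfl⟩
    rw [sum_eq] at hk
    let n : Fin d →₀ ℕ := Finsupp.equivFunOnFinite.symm fun i => k (v i.succ)
    have hn : n.sum (fun _ e => e) ≤ m := by
      rw [Finsupp.sum_fintype _ _ (fun _ => rfl)]
      change ∑ i : Fin d, k (v i.succ) ≤ m
      omega
    exact ⟨⟨n, hn⟩, key k ⟨n, hn⟩ (fun i => rfl) hk⟩
  · rintro ⟨n, rfl⟩
    let k : Space d → ℕ := Function.extend v (Fin.cons (m - ∑ i, n.1 i) fun i => n.1 i) 0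
    have hk0 : k (v 0) = m - ∑ i, n.1 i := by
      simp [k, hv.extend_apply]
    have hki : ∀ i : Fin d, k (v i.succ) = n.1 i := fun i => by
      simp [k, hv.extend_apply]
    have hsum : k (v 0) + ∑ i : Fin d, k (v i.succ) = m := by
      rw [hk0, Finset.sum_congr rfl fun i _ => hki i]
      exact Nat.sub_add_cancel n.sum_le
    exact ⟨k, by rw [sum_eq]; exact hsum, (key k n (fun i => (hki i).symm) hsum).symm⟩

/-- An enumeration of the vertices of a simplex. -/
theorem exists_vertices {d : ℕ} {s : Finset (Space d)} (hs : s.card = d + 1)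
    (hi : AffineIndependent ℝ ((↑) : s → Space d)) :
    ∃ v : Fin (d + 1) → Space d, AffineIndependent ℝ v ∧ (s : Set (Space d)) = Set.range v := by
  let e : Fin (d + 1) ≃ s := (Fintype.equivFinOfCardEq (by simpa using hs)).symm
  refine ⟨fun i => e i, hi.comp_embedding e.toEmbedding, ?_⟩
  ext x
  constructor
  · intro hx
    exact ⟨e.symm ⟨x, hx⟩, by simp⟩
  · rintro ⟨i, rfl⟩
    exact (e i).2

/-- Polynomials of degree at most `m` on a simplex, compared with their values at the lattice
points, with constants that do not depend on the simplex. -/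
theorem exists_simplex_bounds (d : ℕ) {m : ℕ} (hm : 1 ≤ m) :
    ∃ C : ℝ, 0 < C ∧ ∀ s : Finset (Space d), s.card = d + 1 →
      AffineIndependent ℝ ((↑) : s → Space d) →
      ∀ q : MvPolynomial (Fin d) ℝ, q.totalDegree ≤ m →
      (∀ x ∈ Triangulation.body s, ∃ y ∈ Triangulation.latticePoints m s,
        polyEval x q ^ 2 ≤ C * polyEval y q ^ 2) ∧
      ∀ y ∈ Triangulation.latticePoints m s,
        polyEval y q ^ 2 * volume.real (Triangulation.body s)
          ≤ C * ∫ x in Triangulation.body s, polyEval x q ^ 2 := by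
  obtain ⟨C, hC, hb⟩ := exists_reference_bounds d hm
  obtain ⟨n, hn⟩ : ∃ n : ℝ, n = (Fintype.card (LatticeIndex d m) : ℝ) := ⟨_, rfl⟩
  set ρ : ℝ := volume.real (refSimplex d) with hρ
  have hρ0 : 0 ≤ ρ := measureReal_nonneg
  have hn0 : 0 ≤ n := hn ▸ Nat.cast_nonneg _
  -- `C * n` bounds a sum over `n` nodes by its maximum, `ρ * C` absorbs the reference volume, and
  -- `1` gives positivity.
  refine ⟨C * n + ρ * C + 1, by positivity, fun s hs hi q hq => ?_⟩
  obtain ⟨v, hv, hsv⟩ := exists_vertices hs hi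
  obtain ⟨r, hr, hrq⟩ := exists_pullback v q
  obtain ⟨h1, h2⟩ := hb r (hr.trans hq)
  have hbody : Triangulation.body s = convexHull ℝ (Set.range v) := by
    rw [Triangulation.body, hsv]
  constructor
  · intro x hx
    rw [hbody, ← image_refSimplex] at hx
    obtain ⟨z, hz, rfl⟩ := hx
    have : Nonempty (LatticeIndex d m) := ⟨⟨0, by simp⟩⟩
    obtain ⟨k, hk⟩ := Finite.exists_max fun k : LatticeIndex d m =>
      polyEval (latticePoint k) r ^ 2
    refine ⟨simplexMap v (latticePoint k), (mem_latticePoints_iff hm hv.injective hsv _).2 ⟨k, rfl⟩,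
      ?_⟩
    rw [← hrq, ← hrq]
    have h3 : ∑ k : LatticeIndex d m, polyEval (latticePoint k) r ^ 2
        ≤ n * polyEval (latticePoint k) r ^ 2 := by
      refine (Finset.sum_le_sum fun j _ => hk j).trans ?_
      simp [hn]
    refine ((h1 z hz).trans (mul_le_mul_of_nonneg_left h3 hC.le)).trans ?_
    rw [← mul_assoc]
    exact mul_le_mul_of_nonneg_right (by nlinarith) (sq_nonneg _)
  · intro y hy
    obtain ⟨k, rfl⟩ := (mem_latticePoints_iff hm hv.injective hsv _).1 hy
    have hvol : volume.real (Triangulation.body s) = |(simplexLinear v).det| * ρ := by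
      have := setIntegral_simplex hv (fun _ => (1 : ℝ))
      rw [← hbody] at this
      simpa using this
    rw [hvol, hbody, setIntegral_simplex hv, ← hrq]
    simp_rw [← hrq]
    set J := ∫ x in refSimplex d, polyEval x r ^ 2
    have hJ : 0 ≤ J := integral_nonneg fun _ => sq_nonneg _
    have hδ := abs_nonneg (simplexLinear v).det
    -- Cell volume and cell integral scale by the same `|det|`, which is why the constant does not
    -- see the simplex.
    have h3 := mul_le_mul_of_nonneg_right (h2 k) (mul_nonneg hδ hρ0)
    refine h3.trans ?_
    have : 0 ≤ |(simplexLinear v).det| * J := mul_nonneg hδ hJ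
    nlinarith [mul_nonneg (mul_nonneg hC.le hn0) this]

/-! ### Geometry of the cells. -/

namespace LRTD.Triangulation

variable {d : ℕ} {Ω : Set (Space d)}

theorem finite_cells (𝒯 : Triangulation Ω) : 𝒯.cells.Finite :=
  𝒯.finite.subset fun _ hs => hs.1

theorem indep_of_mem_cells (𝒯 : Triangulation Ω) {s : Finset (Space d)} (hs : s ∈ 𝒯.cells) :
    AffineIndependent ℝ ((↑) : s → Space d) := 𝒯.complex.indep hs.1

theorem exists_cell_mem_body (𝒯 : Triangulation Ω) {x : Space d} (hx : x ∈ closure Ω) :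
    ∃ s ∈ 𝒯.cells, x ∈ body s := by
  rw [← 𝒯.space_eq, Geometry.SimplicialComplex.mem_space_iff] at hx
  obtain ⟨s, hs, hxs⟩ := hx
  obtain ⟨t, ht, hst, hcard⟩ := 𝒯.pure s hs
  exact ⟨t, ⟨ht, hcard⟩, convexHull_mono (by exact_mod_cast hst) hxs⟩

theorem body_subset_closure (𝒯 : Triangulation Ω) {s : Finset (Space d)} (hs : s ∈ 𝒯.cells) :
    body s ⊆ closure Ω := by
  rw [← 𝒯.space_eq]
  exact Geometry.SimplicialComplex.convexHull_subset_space hs.1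

theorem interior_body_subset (𝒯 : Triangulation Ω) (hΩr : interior (closure Ω) = Ω)
    {s : Finset (Space d)} (hs : s ∈ 𝒯.cells) : interior (body s) ⊆ Ω := by
  rw [← hΩr]
  exact interior_mono (𝒯.body_subset_closure hs)

theorem isCompact_body (s : Finset (Space d)) : IsCompact (body s) :=
  s.finite_toSet.isCompact_convexHull ℝ

theorem convex_body (s : Finset (Space d)) : Convex ℝ (body s) := convex_convexHull ℝ _

theorem interior_body_nonempty (𝒯 : Triangulation Ω) {s : Finset (Space d)}
    (hs : s ∈ 𝒯.cells) : (interior (body s)).Nonempty := by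
  obtain ⟨v, hv, hsv⟩ := exists_vertices hs.2 (𝒯.indep_of_mem_cells hs)
  rw [body, hsv, interior_convexHull_nonempty_iff_affineSpan_eq_top,
    hv.affineSpan_eq_top_iff_card_eq_finrank_add_one]
  simp

theorem body_subset_closure_interior (𝒯 : Triangulation Ω) {s : Finset (Space d)}
    (hs : s ∈ 𝒯.cells) : body s ⊆ closure (interior (body s)) := by
  rw [(convex_body s).closure_interior_eq_closure_of_nonempty_interior
    (𝒯.interior_body_nonempty hs)]
  exact subset_closure

/-- Two cells meet in the hull of their common vertices. If the interiors met, this hull would have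
interior points, hence `d + 1` vertices, and `s` and `t` would coincide. -/
theorem disjoint_interior_body (𝒯 : Triangulation Ω) {s t : Finset (Space d)}
    (hs : s ∈ 𝒯.cells) (ht : t ∈ 𝒯.cells) (hst : s ≠ t) :
    Disjoint (interior (body s)) (interior (body t)) := by
  classical
  rw [Set.disjoint_iff_inter_eq_empty, ← interior_inter, ← Set.not_nonempty_iff_eq_empty]
  intro hne
  have hsub : body s ∩ body t ⊆ convexHull ℝ ((s ∩ t : Finset (Space d)) : Set (Space d)) := by
    rw [Finset.coe_inter]
    exact 𝒯.complex.inter_subset_convexHull hs.1 ht.1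
  have h := hne.mono (interior_mono hsub)
  rw [interior_convexHull_nonempty_iff_affineSpan_eq_top] at h
  have hind : AffineIndependent ℝ ((↑) : (s ∩ t : Finset (Space d)) → Space d) :=
    (𝒯.indep_of_mem_cells hs).mono (s := ((s ∩ t : Finset (Space d)) : Set (Space d)))
      (t := (s : Set (Space d))) (by exact_mod_cast Finset.inter_subset_left)
  have hr : Set.range ((↑) : (s ∩ t : Finset (Space d)) → Space d)
      = ((s ∩ t : Finset (Space d)) : Set (Space d)) := Subtype.range_coe
  rw [← hr, hind.affineSpan_eq_top_iff_card_eq_finrank_add_one] at h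
  simp only [Fintype.card_coe, finrank_euclideanSpace, Fintype.card_fin] at h
  have h1 : s ∩ t = s := Finset.eq_of_subset_of_card_le Finset.inter_subset_left (by rw [h, hs.2])
  have h2 : s ∩ t = t := Finset.eq_of_subset_of_card_le Finset.inter_subset_right (by rw [h, ht.2])
  exact hst (h1.symm.trans h2)

theorem cells_nonempty (𝒯 : Triangulation Ω) (hΩn : Ω.Nonempty) : 𝒯.cells.Nonempty := by
  obtain ⟨x, hx⟩ := hΩn
  obtain ⟨s, hs, -⟩ := 𝒯.exists_cell_mem_body (subset_closure hx)
  exact ⟨s, hs⟩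

theorem diam_body_pos (hd : 0 < d) (𝒯 : Triangulation Ω) {s : Finset (Space d)}
    (hs : s ∈ 𝒯.cells) : 0 < Metric.diam (body s) := by
  have h1 : 1 < s.card := by rw [hs.2]; omega
  obtain ⟨x, hx, y, hy, hxy⟩ := Finset.one_lt_card.1 h1
  exact (dist_pos.2 hxy).trans_le (Metric.dist_le_diam_of_mem (isCompact_body s).isBounded
    (subset_convexHull ℝ _ hx) (subset_convexHull ℝ _ hy))

theorem meshSize_le_diam (𝒯 : Triangulation Ω) {s : Finset (Space d)} (hs : s ∈ 𝒯.cells) :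
    𝒯.meshSize ≤ Metric.diam (body s) :=
  csInf_le (𝒯.finite_cells.image _).bddBelow ⟨s, hs, rfl⟩

/-- The infimum is over a finite nonempty set, hence attained by a cell, and cells have positive
diameter when `0 < d`. -/
theorem meshSize_pos (hd : 0 < d) (𝒯 : Triangulation Ω) (hΩn : Ω.Nonempty) :
    0 < 𝒯.meshSize := by
  obtain ⟨s, hs, h⟩ := ((𝒯.cells_nonempty hΩn).image _).csInf_mem
    (𝒯.finite_cells.image fun s => Metric.diam (body s))
  rw [meshSize, ← h]
  exact 𝒯.diam_body_pos hd hs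

theorem volume_body_ge (hd : 0 < d) (𝒯 : Triangulation Ω) (hΩn : Ω.Nonempty) {γ : ℝ} (hγ : 0 < γ)
    (hq : 𝒯.IsQuasiUniform γ) {s : Finset (Space d)} (hs : s ∈ 𝒯.cells) :
    (𝒯.meshSize / γ) ^ d * volume.real (Metric.ball (0 : Space d) 1)
      ≤ volume.real (body s) := by
  obtain ⟨⟨c, hc⟩, -⟩ := hq s hs
  have h0 := (𝒯.meshSize_pos hd hΩn).le
  have h := Measure.addHaar_real_closedBall (volume : Measure (Space d)) c
    (div_nonneg h0 hγ.le)
  rw [finrank_euclideanSpace, Fintype.card_fin] at h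
  rw [← h]
  refine measureReal_mono ((Metric.closedBall_subset_closedBall ?_).trans hc)
    (isCompact_body s).measure_lt_top.ne
  exact div_le_div_of_nonneg_right (𝒯.meshSize_le_diam hs) hγ.le

theorem latticePoints_subset_body {m : ℕ} (hm : 1 ≤ m) (s : Finset (Space d)) :
    latticePoints m s ⊆ body s := by
  rintro _ ⟨k, hk, rfl⟩
  have hm0 : (m : ℝ) ≠ 0 := by positivity
  refine (convex_body s).sum_mem (fun v _ => by positivity) ?_
    (fun v hv => subset_convexHull ℝ _ hv)
  rw [← Finset.sum_div, div_eq_one_iff_eq hm0]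
  exact_mod_cast hk

end LRTD.Triangulation

/-! ### Mesh-independent equivalence of coefficient and `L²` norms. -/

namespace LRTD.NodalBasis

open Triangulation

variable {d : ℕ} {Ω : Set (Space d)} {𝒯 : Triangulation Ω} {m M : ℕ}

/-- The continuous representative of the finite element function with given coefficients. -/
def rep (B : NodalBasis 𝒯 m M) (c : Fin M → ℝ) (x : Space d) : ℝ := ∑ i, c i * B.shape i x

theorem continuous_rep (B : NodalBasis 𝒯 m M) (c : Fin M → ℝ) : Continuous (B.rep c) :=
  continuous_finsetSum _ fun i _ => continuous_const.mul (B.shape_continuous i)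

theorem rep_eq_zero (B : NodalBasis 𝒯 m M) (c : Fin M → ℝ) {x : Space d} (hx : x ∉ Ω) :
    B.rep c x = 0 :=
  Finset.sum_eq_zero fun i _ => by rw [B.shape_eq_zero i x hx, mul_zero]

theorem rep_node (B : NodalBasis 𝒯 m M) (c : Fin M → ℝ) (j : Fin M) :
    B.rep c (B.node j) = c j := by
  simp [rep, B.shape_node]

theorem toFE_mem (B : NodalBasis 𝒯 m M) (c : Fin M → ℝ) : B.toFE c ∈ 𝒯.feSpace m := by
  rw [toFE, Fintype.linearCombination_apply]
  exact Submodule.sum_mem _ fun i _ => Submodule.smul_mem _ _ (B.basis i).2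

theorem toL2_toFE (B : NodalBasis 𝒯 m M) (c : Fin M → ℝ) :
    (toL2 (B.toFE c) : Space d → ℝ) =ᵐ[volume.restrict Ω] B.rep c := by
  have h : toL2 (B.toFE c) = ∑ i, c i • toL2 (B.basis i : H10 Ω) := by
    rw [toFE, Fintype.linearCombination_apply, map_sum]
    simp_rw [map_smul]
  rw [h]
  have h1 := Lp.coeFn_finsetSum Finset.univ fun i => c i • toL2 (B.basis i : H10 Ω)
  have h2 : ∀ᵐ x ∂(volume.restrict Ω), ∀ i,
      (c i • toL2 (B.basis i : H10 Ω) : Lp ℝ 2 (volume.restrict Ω)) x = c i * B.shape i x := by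
    rw [ae_all_iff]
    intro i
    filter_upwards [Lp.coeFn_smul (c i) (toL2 (B.basis i : H10 Ω)), B.shape_ae i] with x hx hx'
    rw [hx, Pi.smul_apply, hx', smul_eq_mul]
  filter_upwards [h1, h2] with x hx hx'
  rw [hx, rep, Finset.sum_apply]
  exact Finset.sum_congr rfl fun i _ => hx' i

theorem norm_toL2_toFE_sq (B : NodalBasis 𝒯 m M) (c : Fin M → ℝ) :
    ‖toL2 (B.toFE c)‖ ^ 2 = ∫ x in Ω, B.rep c x ^ 2 := by
  rw [Lp_norm_sq_eq_integral]
  refine integral_congr_ae ?_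
  filter_upwards [B.toL2_toFE c] with x hx
  exact congrArg (· ^ 2) hx

/-- Membership in `feSpace` is an almost-everywhere statement in `Ω`. Cell interiors lie in `Ω`
because `Ω` is the interior of its closure; continuity gives equality there, and density extends it
to the closed cell. -/
theorem exists_poly_rep (B : NodalBasis 𝒯 m M) (hΩr : interior (closure Ω) = Ω) (c : Fin M → ℝ)
    {s : Finset (Space d)} (hs : s ∈ 𝒯.cells) :
    ∃ q : MvPolynomial (Fin d) ℝ, q.totalDegree ≤ m ∧ ∀ x ∈ body s, B.rep c x = polyEval x q := by
  obtain ⟨q, hq, hqe⟩ := B.toFE_mem c s hs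
  refine ⟨q, hq, ?_⟩
  have hi := 𝒯.interior_body_subset hΩr hs
  have h : B.rep c =ᵐ[volume.restrict (interior (body s))] fun x => polyEval x q := by
    filter_upwards [ae_restrict_of_ae_restrict_of_subset hi hqe,
      ae_restrict_of_ae_restrict_of_subset hi (B.toL2_toFE c),
      ae_restrict_mem isOpen_interior.measurableSet] with x h1 h2 h3
    rw [← h2, h1 (interior_subset h3)]
  exact (Measure.eqOn_open_of_ae_eq h isOpen_interior (B.continuous_rep c).continuousOn
    (continuous_polyEval q).continuousOn).of_subset_closure (B.continuous_rep c).continuousOn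
    (continuous_polyEval q).continuousOn interior_subset (𝒯.body_subset_closure_interior hs)

/-- The values of a finite element function are bounded by the coefficients that belong to nearby
nodes. -/
theorem rep_sq_le (B : NodalBasis 𝒯 m M) (hΩr : interior (closure Ω) = Ω) (hm : 1 ≤ m)
    {γ : ℝ} (hq : 𝒯.IsQuasiUniform γ) {C : ℝ} (hC : 0 < C)
    (hb : ∀ s : Finset (Space d), s.card = d + 1 → AffineIndependent ℝ ((↑) : s → Space d) →
      ∀ q : MvPolynomial (Fin d) ℝ, q.totalDegree ≤ m →
      ∀ x ∈ body s, ∃ y ∈ latticePoints m s, polyEval x q ^ 2 ≤ C * polyEval y q ^ 2)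
    (c : Fin M → ℝ) {x : Space d} (hx : x ∈ Ω) :
    B.rep c x ^ 2 ≤ ∑ i, (Metric.closedBall (B.node i) (γ * 𝒯.meshSize)).indicator
      (fun _ => C * c i ^ 2) x := by
  obtain ⟨s, hs, hxs⟩ := 𝒯.exists_cell_mem_body (subset_closure hx)
  obtain ⟨q, hqd, hqe⟩ := B.exists_poly_rep hΩr c hs
  obtain ⟨y, hy, hxy⟩ := hb s hs.2 (𝒯.indep_of_mem_cells hs) q hqd x hxs
  have hys := latticePoints_subset_body hm s hy
  rw [← hqe x hxs, ← hqe y hys] at hxy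
  have h0 : ∀ i, 0 ≤ (Metric.closedBall (B.node i) (γ * 𝒯.meshSize)).indicator
      (fun _ => C * c i ^ 2) x := fun i =>
    Set.indicator_nonneg (fun _ _ => mul_nonneg hC.le (sq_nonneg _)) x
  -- Either the dominating lattice point `y` is an interior node, within `diam ≤ γ h` of `x`, or it
  -- lies outside `Ω`, where the representative vanishes.
  by_cases hyΩ : y ∈ Ω
  · have hyn : y ∈ Set.range B.node := by rw [B.range_node]; exact ⟨hyΩ, s, hs, hy⟩
    obtain ⟨i, rfl⟩ := hyn
    rw [B.rep_node] at hxy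
    refine hxy.trans (le_trans (le_of_eq ?_)
      (Finset.single_le_sum (fun i _ => h0 i) (Finset.mem_univ i)))
    rw [Set.indicator_of_mem]
    exact Metric.mem_closedBall.2 ((Metric.dist_le_diam_of_mem (isCompact_body s).isBounded
      hxs hys).trans (hq s hs).2)
  · rw [B.rep_eq_zero c hyΩ] at hxy
    refine (hxy.trans (by simp)).trans (Finset.sum_nonneg fun i _ => h0 i)

theorem integrableOn_rep_sq (B : NodalBasis 𝒯 m M) (c : Fin M → ℝ) {s : Set (Space d)}
    (hs : Bornology.IsBounded s) : IntegrableOn (fun x => B.rep c x ^ 2) s :=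
  (((B.continuous_rep c).pow 2).continuousOn.integrableOn_compact
    hs.isCompact_closure).mono_set subset_closure

/-- Integrating `rep_sq_le` charges each coefficient with the volume of one ball of radius `γ h`, so
the number of cells meeting at a node need not be bounded. -/
theorem norm_toFE_sq_le (B : NodalBasis 𝒯 m M) (hd : 0 < d) (hΩo : IsOpen Ω)
    (hΩb : Bornology.IsBounded Ω) (hΩn : Ω.Nonempty)
    (hΩr : interior (closure Ω) = Ω) (hm : 1 ≤ m)
    {γ : ℝ} (hγ : 0 < γ) (hq : 𝒯.IsQuasiUniform γ) {C : ℝ} (hC : 0 < C)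
    (hb : ∀ s : Finset (Space d), s.card = d + 1 → AffineIndependent ℝ ((↑) : s → Space d) →
      ∀ q : MvPolynomial (Fin d) ℝ, q.totalDegree ≤ m →
      ∀ x ∈ body s, ∃ y ∈ latticePoints m s, polyEval x q ^ 2 ≤ C * polyEval y q ^ 2)
    (c : Fin M → ℝ) :
    ‖toL2 (B.toFE c)‖ ^ 2 ≤ C * γ ^ d * volume.real (Metric.ball (0 : Space d) 1) *
      𝒯.meshSize ^ d * ∑ i, c i ^ 2 := by
  have hfin : volume Ω < ⊤ := hΩb.measure_lt_top
  have hh := (𝒯.meshSize_pos hd hΩn).le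
  have hint : ∀ i, IntegrableOn ((Metric.closedBall (B.node i) (γ * 𝒯.meshSize)).indicator
      (fun _ => C * c i ^ 2)) Ω := fun i =>
    (integrableOn_const hfin.ne).indicator Metric.isClosed_closedBall.measurableSet
  rw [norm_toL2_toFE_sq]
  refine (setIntegral_mono_on (B.integrableOn_rep_sq c hΩb)
    (integrable_finsetSum Finset.univ fun i _ => hint i) hΩo.measurableSet
    fun x hx => B.rep_sq_le hΩr hm hq hC hb c hx).trans ?_
  rw [integral_finsetSum _ fun i _ => hint i, Finset.mul_sum]
  refine Finset.sum_le_sum fun i _ => ?_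
  rw [setIntegral_indicator Metric.isClosed_closedBall.measurableSet, setIntegral_const,
    smul_eq_mul]
  have h1 : volume.real (Ω ∩ Metric.closedBall (B.node i) (γ * 𝒯.meshSize))
      ≤ (γ * 𝒯.meshSize) ^ d * volume.real (Metric.ball (0 : Space d) 1) := by
    have h := Measure.addHaar_real_closedBall (volume : Measure (Space d)) (B.node i)
      (mul_nonneg hγ.le hh)
    rw [finrank_euclideanSpace, Fintype.card_fin] at h
    rw [← h]
    exact measureReal_mono Set.inter_subset_right (isCompact_closedBall _ _).measure_lt_top.ne
  refine (mul_le_mul_of_nonneg_right h1 (mul_nonneg hC.le (sq_nonneg _))).trans (le_of_eq ?_)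
  rw [mul_pow]; ring

/-- Each node is assigned to one cell containing it, whose integral controls the coefficient. A cell
receives at most as many nodes as it has lattice points, and cells do not overlap. -/
theorem sum_sq_le_norm_toFE_sq (B : NodalBasis 𝒯 m M) (hd : 0 < d)
    (hΩb : Bornology.IsBounded Ω) (hΩn : Ω.Nonempty)
    (hΩr : interior (closure Ω) = Ω) (hm : 1 ≤ m)
    {γ : ℝ} (hγ : 0 < γ) (hq : 𝒯.IsQuasiUniform γ) {C : ℝ} (hC : 0 < C)
    (hb : ∀ s : Finset (Space d), s.card = d + 1 → AffineIndependent ℝ ((↑) : s → Space d) →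
      ∀ q : MvPolynomial (Fin d) ℝ, q.totalDegree ≤ m →
      ∀ y ∈ latticePoints m s, polyEval y q ^ 2 * volume.real (body s)
        ≤ C * ∫ x in body s, polyEval x q ^ 2)
    (c : Fin M → ℝ) :
    (𝒯.meshSize / γ) ^ d * volume.real (Metric.ball (0 : Space d) 1) * ∑ i, c i ^ 2
      ≤ C * Fintype.card (LatticeIndex d m) * ‖toL2 (B.toFE c)‖ ^ 2 := by
  classical
  have hcell : ∀ i, ∃ s ∈ 𝒯.cells, B.node i ∈ latticePoints m s := fun i => by
    have : B.node i ∈ 𝒯.interiorNodes m := by rw [← B.range_node]; exact ⟨i, rfl⟩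
    exact this.2
  choose t ht hit using hcell
  set F := 𝒯.finite_cells.toFinset with hF
  have hFm : ∀ {s}, s ∈ F ↔ s ∈ 𝒯.cells := 𝒯.finite_cells.mem_toFinset
  have local_le : ∀ i, (𝒯.meshSize / γ) ^ d * volume.real (Metric.ball (0 : Space d) 1) * c i ^ 2
      ≤ C * ∫ x in body (t i), B.rep c x ^ 2 := by
    intro i
    obtain ⟨q, hqd, hqe⟩ := B.exists_poly_rep hΩr c (ht i)
    have h1 := hb (t i) (ht i).2 (𝒯.indep_of_mem_cells (ht i)) q hqd _ (hit i)
    rw [← hqe _ (latticePoints_subset_body hm _ (hit i)), B.rep_node] at h1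
    rw [setIntegral_congr_fun (isCompact_body (t i)).measurableSet
      (fun x hx => congrArg (· ^ 2) (hqe x hx))]
    refine le_trans ?_ h1
    rw [mul_comm]
    exact mul_le_mul_of_nonneg_left (𝒯.volume_body_ge hd hΩn hγ hq (ht i)) (sq_nonneg _)
  have hcard : ∀ s ∈ F, ((Finset.univ.filter fun i => t i = s).card : ℝ)
      ≤ Fintype.card (LatticeIndex d m) := by
    intro s hs
    obtain ⟨v, hv, hsv⟩ := exists_vertices (hFm.1 hs).2 (𝒯.indep_of_mem_cells (hFm.1 hs))
    have hk : ∀ i : {i // t i = s}, ∃ k : LatticeIndex d m,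
        B.node i = simplexMap v (latticePoint k) := fun i =>
      by
      have h := hit i.1
      rw [i.2] at h
      exact (mem_latticePoints_iff hm hv.injective hsv _).1 h
    choose k hk using hk
    have hinj : Function.Injective k := fun i j hij => by
      refine Subtype.ext (B.node_injective ?_)
      rw [hk, hk, hij]
    have := Fintype.card_le_of_injective k hinj
    rw [Fintype.card_subtype] at this
    exact_mod_cast this
  have hsum : ∑ s ∈ F, ∫ x in body s, B.rep c x ^ 2 ≤ ∫ x in Ω, B.rep c x ^ 2 := by
    -- Convex sets have null boundary, so the integrals may be taken over the disjoint interiors.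
    have h1 : ∀ s ∈ F, ∫ x in body s, B.rep c x ^ 2 = ∫ x in interior (body s), B.rep c x ^ 2 :=
      fun s _ => setIntegral_congr_set (interior_ae_eq_of_null_frontier
        ((convex_body s).addHaar_frontier volume)).symm
    rw [Finset.sum_congr rfl h1, ← integral_biUnion_finset F
      (fun s _ => isOpen_interior.measurableSet)
      (fun s hs t ht hst => 𝒯.disjoint_interior_body (hFm.1 hs) (hFm.1 ht) hst)
      (fun s _ => B.integrableOn_rep_sq c ((isCompact_body s).isBounded.subset interior_subset))]
    refine setIntegral_mono_set (B.integrableOn_rep_sq c hΩb)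
      (Filter.Eventually.of_forall fun x => sq_nonneg _) (LE.le.eventuallyLE ?_)
    exact Set.iUnion₂_subset fun s hs => 𝒯.interior_body_subset hΩr (hFm.1 hs)
  have hpos : ∀ s, 0 ≤ ∫ x in body s, B.rep c x ^ 2 := fun s => integral_nonneg fun _ => sq_nonneg _
  rw [Finset.mul_sum, norm_toL2_toFE_sq, mul_assoc C]
  refine (Finset.sum_le_sum fun i _ => local_le i).trans ?_
  rw [← Finset.mul_sum]
  refine mul_le_mul_of_nonneg_left ?_ hC.le
  rw [← Finset.sum_fiberwise_of_maps_to (t := F) (g := t) fun i _ => hFm.2 (ht i)]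
  refine le_trans ?_ (mul_le_mul_of_nonneg_left hsum (Nat.cast_nonneg _))
  rw [Finset.mul_sum]
  refine Finset.sum_le_sum fun s hs => ?_
  rw [Finset.sum_congr rfl (g := fun _ => ∫ x in body s, B.rep c x ^ 2)
    fun i hi => by rw [(Finset.mem_filter.1 hi).2], Finset.sum_const, nsmul_eq_mul]
  exact mul_le_mul_of_nonneg_right (hcard s hs) (hpos s)

end LRTD.NodalBasis

/-- On quasi-uniform triangulations the mass matrix is, up to constants that do not depend on
the triangulation, a multiple of the identity. -/
theorem exists_mass_equivalence {d : ℕ} (hd : 0 < d) {Ω : Set (Space d)} (hΩo : IsOpen Ω)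
    (hΩb : Bornology.IsBounded Ω) (hΩn : Ω.Nonempty) (hΩr : interior (closure Ω) = Ω)
    {m : ℕ} (hm : 1 ≤ m) {γ : ℝ} (hγ : 0 < γ) :
    ∃ κ : ℝ, 0 < κ ∧ ∀ 𝒯 : Triangulation Ω, 𝒯.IsQuasiUniform γ →
      ∀ (M : ℕ) (B : NodalBasis 𝒯 m M), ∃ μ : ℝ, 0 < μ ∧ ∀ c : Fin M → ℝ,
        ‖toL2 (B.toFE c)‖ ^ 2 ≤ κ * (μ * ∑ i, c i ^ 2) ∧
        μ * ∑ i, c i ^ 2 ≤ κ * ‖toL2 (B.toFE c)‖ ^ 2 := by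
  obtain ⟨C, hC, hb⟩ := exists_simplex_bounds d hm
  set b := volume.real (Metric.ball (0 : Space d) 1) with hbdef
  have hb0 : 0 < b := ENNReal.toReal_pos (Metric.measure_ball_pos volume _ one_pos).ne'
    Metric.isBounded_ball.measure_lt_top.ne
  obtain ⟨n, hn⟩ : ∃ n : ℝ, n = (Fintype.card (LatticeIndex d m) : ℝ) := ⟨_, rfl⟩
  have hn0 : 0 ≤ n := hn ▸ Nat.cast_nonneg _
  -- `κ` adds the constants of the upper and lower bounds so that it serves for both; `μ = h^d`
  -- carries all dependence on the mesh.
  refine ⟨C * γ ^ d * b + C * n * γ ^ d / b, by positivity, fun 𝒯 hq M B =>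
    ⟨𝒯.meshSize ^ d, pow_pos (𝒯.meshSize_pos hd hΩn) d, fun c => ?_⟩⟩
  have h1 := B.norm_toFE_sq_le hd hΩo hΩb hΩn hΩr hm hγ hq hC
    (fun s hs hi q hqd => (hb s hs hi q hqd).1) c
  have h2 := B.sum_sq_le_norm_toFE_sq hd hΩb hΩn hΩr hm hγ hq hC
    (fun s hs hi q hqd => (hb s hs hi q hqd).2) c
  have hμ := pow_pos (𝒯.meshSize_pos hd hΩn) d
  set μ := 𝒯.meshSize ^ d with hμd
  have hs : 0 ≤ ∑ i, c i ^ 2 := Finset.sum_nonneg fun _ _ => sq_nonneg _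
  rw [← hbdef, ← hn, div_pow, ← hμd] at h2
  rw [← hbdef] at h1
  constructor
  · refine h1.trans ?_
    rw [mul_assoc _ μ]
    exact mul_le_mul_of_nonneg_right (le_add_of_nonneg_right (by positivity)) (by positivity)
  · have h3 : μ * ∑ i, c i ^ 2 ≤ C * n * γ ^ d / b * ‖toL2 (B.toFE c)‖ ^ 2 := by
      have h4 := mul_le_mul_of_nonneg_left h2 (show 0 ≤ γ ^ d / b by positivity)
      calc μ * ∑ i, c i ^ 2 = γ ^ d / b * (μ / γ ^ d * b * ∑ i, c i ^ 2) := by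
            field_simp
        _ ≤ _ := h4
        _ = _ := by ring
    exact h3.trans (mul_le_mul_of_nonneg_right (le_add_of_nonneg_left (by positivity))
      (sq_nonneg _))

/-! ### Parametric derivatives and pointwise bounds on snapshots. -/

theorem length_directions {D : ℕ} (j : Fin D → ℕ) : (directions j).length = ∑ i, j i := by
  simp [directions, List.length_flatMap, ← List.ofFn_eq_map, List.sum_ofFn]

theorem length_directions_le {D p : ℕ} {j : Fin D → ℕ} (hj : j ∈ multiIndices D p) :
    (directions j).length ≤ p := by
  rw [length_directions]
  simp only [multiIndices, Finset.mem_biUnion, Finset.mem_range, Finset.mem_piAntidiag] at hj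
  obtain ⟨n, hn, hs, -⟩ := hj
  change ∑ i, j i = n at hs
  omega

theorem zero_mem_multiIndices (D p : ℕ) : (0 : Fin D → ℕ) ∈ multiIndices D p := by
  simp only [multiIndices, Finset.mem_biUnion, Finset.mem_range, Finset.mem_piAntidiag]
  exact ⟨0, Nat.succ_pos p, by simp, by simp⟩

theorem partialDeriv_zero {D : ℕ} (A : Set (Fin D → ℝ)) (g : (Fin D → ℝ) → ℝ) (α : Fin D → ℝ) :
    partialDeriv A 0 g α = g α := by
  have h : ∀ (l : List (Fin D)), l = [] →
      iteratedFDerivWithin ℝ l.length g A α (fun r => Pi.single (l.get r) (1 : ℝ)) = g α := by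
    rintro _ rfl
    exact iteratedFDerivWithin_zero_apply _
  exact h _ (List.length_eq_zero_iff.1 (by rw [length_directions]; simp))

/-- With `c i = ξ_i(x)` this makes a parametric derivative of `u_h(α)(x)` a combination of shape
functions, hence continuous in `x`. -/
theorem partialDeriv_sum {D : ℕ} {ι : Type*} {A : Set (Fin D → ℝ)} (hA : UniqueDiffOn ℝ A)
    {p : ℕ} {j : Fin D → ℕ} (hj : (directions j).length ≤ p) (t : Finset ι)
    {a : ι → (Fin D → ℝ) → ℝ} (ha : ∀ i ∈ t, ContDiffOn ℝ p (a i) A) (c : ι → ℝ)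
    {α : Fin D → ℝ} (hα : α ∈ A) :
    partialDeriv A j (fun β => ∑ i ∈ t, a i β * c i) α
      = ∑ i ∈ t, partialDeriv A j (a i) α * c i := by
  have hc : ∀ i ∈ t, ContDiffWithinAt ℝ ((directions j).length : ℕ) (a i) A α := fun i hi =>
    ((ha i hi).of_le (by exact_mod_cast hj)) α hα
  have hf : (fun β => ∑ i ∈ t, a i β * c i) = ∑ i ∈ t, c i • a i := by
    ext β
    simp [Finset.sum_apply, mul_comm]
  rw [partialDeriv, hf, iteratedFDerivWithin_sum_apply (f := fun i => c i • a i) hA hα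
    fun i hi => (hc i hi).const_smul (c i), sum_apply]
  refine Finset.sum_congr rfl fun i hi => ?_
  rw [iteratedFDerivWithin_const_smul_apply (hc i hi) hA hα, smul_apply,
    smul_eq_mul, mul_comm]
  rfl

theorem uniqueDiffOn_box {D : ℕ} {lo hi : Fin D → ℝ} (h : ∀ i, lo i < hi i) :
    UniqueDiffOn ℝ (Set.Icc lo hi) := by
  rw [← Set.pi_univ_Icc]
  exact UniqueDiffOn.univ_pi fun i => uniqueDiffOn_Icc (h i)

/-- The continuous functions `max F c` and `c` agree almost everywhere, hence everywhere on `U`. -/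
theorem le_of_ae_le_of_isOpen {X : Type*} [TopologicalSpace X] [MeasurableSpace X]
    {μ : Measure X} [μ.IsOpenPosMeasure] {U : Set X} (hU : IsOpen U) {F : X → ℝ}
    (hF : Continuous F) {c : ℝ} (h : ∀ᵐ x ∂(μ.restrict U), F x ≤ c) : ∀ x ∈ U, F x ≤ c := by
  have h1 : (fun x => max (F x) c) =ᵐ[μ.restrict U] fun _ => c := by
    filter_upwards [h] with x hx using max_eq_right hx
  intro x hx
  exact max_eq_right_iff.1 (Measure.eqOn_open_of_ae_eq h1 hU
    (hF.max continuous_const).continuousOn continuousOn_const hx)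

theorem norm_sum_smul_sq {ι E : Type*} [Fintype ι] [NormedAddCommGroup E] [InnerProductSpace ℝ E]
    (b : ι → E) (c : ι → ℝ) :
    ‖∑ i, c i • b i‖ ^ 2 = ∑ i, ∑ k, c k * inner ℝ (b i) (b k) * c i := by
  rw [← real_inner_self_eq_norm_sq, sum_inner]
  refine Finset.sum_congr rfl fun i _ => ?_
  rw [inner_sum]
  refine Finset.sum_congr rfl fun k _ => ?_
  rw [real_inner_smul_left, real_inner_smul_right]
  ring

namespace LRTD.NodalBasis

variable {d D : ℕ} {Ω : Set (Space d)} {𝒯 : Triangulation Ω} {m M : ℕ}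

theorem toFE_coeffs (B : NodalBasis 𝒯 m M) (v : 𝒯.feSpace m) : B.toFE (B.coeffs v) = v := by
  have h := congrArg (Submodule.subtype _) (B.basis.sum_repr v)
  rw [map_sum] at h
  rw [toFE, Fintype.linearCombination_apply]
  exact h

theorem eval_eq_rep (B : NodalBasis 𝒯 m M) (v : 𝒯.feSpace m) (x : Space d) :
    B.eval v x = B.rep (B.coeffs v) x := rfl

theorem node_mem (B : NodalBasis 𝒯 m M) (i : Fin M) : B.node i ∈ Ω := by
  have : B.node i ∈ 𝒯.interiorNodes m := by rw [← B.range_node]; exact ⟨i, rfl⟩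
  exact this.1

/-- The bounds on the parametric derivatives hold at every point of the domain. -/
theorem sum_abs_partialDeriv_le (B : NodalBasis 𝒯 m M) (hΩo : IsOpen Ω) {lo hi : Fin D → ℝ}
    (hbox : ∀ i, lo i < hi i) {p N : ℕ} {Cu : ℝ} {u : (Fin D → ℝ) → ℕ → 𝒯.feSpace m}
    (hu : IsParamSmooth B (Set.Icc lo hi) p N Cu u) {k : ℕ} (hk : 1 ≤ k) (hkN : k ≤ N)
    {x : Space d} (hx : x ∈ Ω) {α : Fin D → ℝ} (hα : α ∈ Set.Icc lo hi) :
    ∑ j ∈ multiIndices D p, |partialDeriv (Set.Icc lo hi) j (fun β => B.eval (u β k) x) α|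
      ≤ max Cu 0 := by
  obtain ⟨hsm, hbd⟩ := hu k hk hkN
  have hA := uniqueDiffOn_box hbox
  -- A nodal coefficient is the value at its own node, which lies in `Ω`, so it inherits the
  -- smoothness in `α`.
  have ha : ∀ i, ContDiffOn ℝ p (fun β => B.coeffs (u β k) i) (Set.Icc lo hi) := fun i => by
    refine (hsm _ (B.node_mem i)).congr fun β _ => ?_
    rw [eval_eq_rep, rep_node]
  have hpd : ∀ j ∈ multiIndices D p, ∀ x, partialDeriv (Set.Icc lo hi) j
      (fun β => B.eval (u β k) x) α
      = ∑ i, partialDeriv (Set.Icc lo hi) j (fun β => B.coeffs (u β k) i) α * B.shape i x :=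
    fun j hj x => partialDeriv_sum hA (length_directions_le hj) Finset.univ
      (fun i _ => ha i) (fun i => B.shape i x) hα
  have hcont : Continuous fun x => ∑ j ∈ multiIndices D p,
      |partialDeriv (Set.Icc lo hi) j (fun β => B.eval (u β k) x) α| := by
    refine continuous_finsetSum _ fun j hj => Continuous.abs ?_
    simp_rw [hpd j hj]
    exact continuous_finsetSum _ fun i _ => continuous_const.mul (B.shape_continuous i)
  refine le_of_ae_le_of_isOpen (μ := volume) hΩo hcont ?_ x hx
  have hall : ∀ᵐ x ∂(volume.restrict Ω), ∀ j ∈ multiIndices D p,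
      ‖partialDeriv (Set.Icc lo hi) j (fun β => B.eval (u β k) x) α‖ₑ
      ≤ eLpNorm (fun x => partialDeriv (Set.Icc lo hi) j (fun β => B.eval (u β k) x) α) ⊤
        (volume.restrict Ω) := by
    refine (ae_ball_iff (Finset.countable_toSet (multiIndices D p))).2 ?_
    intro j _
    rw [eLpNorm_exponent_top]
    exact enorm_ae_le_eLpNormEssSup _ _
  filter_upwards [hall] with x hx
  have h1 := (Finset.sum_le_sum hx).trans (hbd α hα)
  have h2 : ∑ j ∈ multiIndices D p,
      ‖partialDeriv (Set.Icc lo hi) j (fun β => B.eval (u β k) x) α‖ₑ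
      = ENNReal.ofReal (∑ j ∈ multiIndices D p,
        |partialDeriv (Set.Icc lo hi) j (fun β => B.eval (u β k) x) α|) := by
    rw [ENNReal.ofReal_sum_of_nonneg fun _ _ => abs_nonneg _]
    exact Finset.sum_congr rfl fun j _ => Real.enorm_eq_ofReal_abs _
  rw [h2] at h1
  -- `ENNReal.ofReal` truncates a negative `Cu` to zero, whence `max Cu 0`.
  have h3 := ENNReal.ofReal_le_ofReal_iff (q := max Cu 0) (le_max_right _ _)
    |>.1 (h1.trans (ENNReal.ofReal_le_ofReal (le_max_left _ _)))
  exact h3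

theorem cpNorm_eval_le (B : NodalBasis 𝒯 m M) (hΩo : IsOpen Ω) {lo hi : Fin D → ℝ}
    (hbox : ∀ i, lo i < hi i) {p N : ℕ} {Cu : ℝ} {u : (Fin D → ℝ) → ℕ → 𝒯.feSpace m}
    (hu : IsParamSmooth B (Set.Icc lo hi) p N Cu u) {k : ℕ} (hk : 1 ≤ k) (hkN : k ≤ N)
    {x : Space d} (hx : x ∈ Ω) :
    cpNorm (Set.Icc lo hi) p (fun β => B.eval (u β k) x) ≤ max Cu 0 := by
  refine csSup_le ((Set.nonempty_Icc.2 fun i => (hbox i).le).image _) ?_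
  rintro _ ⟨α, hα, rfl⟩
  exact B.sum_abs_partialDeriv_le hΩo hbox hu hk hkN hx hα

theorem abs_eval_le (B : NodalBasis 𝒯 m M) (hΩo : IsOpen Ω) {lo hi : Fin D → ℝ}
    (hbox : ∀ i, lo i < hi i) {p N : ℕ} {Cu : ℝ} {u : (Fin D → ℝ) → ℕ → 𝒯.feSpace m}
    (hu : IsParamSmooth B (Set.Icc lo hi) p N Cu u) {k : ℕ} (hk : 1 ≤ k) (hkN : k ≤ N)
    {x : Space d} (hx : x ∈ Ω) {α : Fin D → ℝ} (hα : α ∈ Set.Icc lo hi) :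
    |B.eval (u α k) x| ≤ max Cu 0 := by
  refine le_trans ?_ (B.sum_abs_partialDeriv_le hΩo hbox hu hk hkN hx hα)
  have := Finset.single_le_sum (f := fun j => |partialDeriv (Set.Icc lo hi) j
    (fun β => B.eval (u β k) x) α|) (fun j _ => abs_nonneg _) (zero_mem_multiIndices D p)
  simpa only [partialDeriv_zero] using this

theorem norm_toFE_sq_le_of_abs_rep_le (B : NodalBasis 𝒯 m M) (hΩo : IsOpen Ω)
    (hΩb : Bornology.IsBounded Ω)
    {c : Fin M → ℝ} {b : ℝ} (h : ∀ x ∈ Ω, |B.rep c x| ≤ b) :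
    ‖toL2 (B.toFE c)‖ ^ 2 ≤ volume.real Ω * b ^ 2 := by
  rw [norm_toL2_toFE_sq]
  refine (setIntegral_mono_on (B.integrableOn_rep_sq c hΩb)
    (integrableOn_const (C := b ^ 2) hΩb.measure_lt_top.ne) hΩo.measurableSet
    fun x hx => ?_).trans ?_
  · rw [← sq_abs]; exact pow_le_pow_left₀ (abs_nonneg _) (h x hx) 2
  · rw [setIntegral_const, smul_eq_mul]

theorem norm_snapshot_sq_le (B : NodalBasis 𝒯 m M) (hΩo : IsOpen Ω)
    (hΩb : Bornology.IsBounded Ω) {lo hi : Fin D → ℝ}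
    (hbox : ∀ i, lo i < hi i) {p N : ℕ} {Cu : ℝ} {u : (Fin D → ℝ) → ℕ → 𝒯.feSpace m}
    (hu : IsParamSmooth B (Set.Icc lo hi) p N Cu u) {k : ℕ} (hk : 1 ≤ k) (hkN : k ≤ N)
    {α : Fin D → ℝ} (hα : α ∈ Set.Icc lo hi) :
    ‖toL2 (u α k : H10 Ω)‖ ^ 2 ≤ volume.real Ω * max Cu 0 ^ 2 := by
  rw [← B.toFE_coeffs]
  exact B.norm_toFE_sq_le_of_abs_rep_le hΩo hΩb fun x hx =>
    B.abs_eval_le hΩo hbox hu hk hkN hx hα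

/-! ### Tensor norms as sums of `L²` norms of columns. -/

/-- The sum of the squared `L²` norms of the finite element functions given by the columns. -/
noncomputable def colNormSq (B : NodalBasis 𝒯 m M) {N : ℕ} (A : Matrix (Fin M) (Fin N) ℝ) : ℝ :=
  ∑ j, ‖toL2 (B.toFE fun i => A i j)‖ ^ 2

theorem colNormSq_nonneg (B : NodalBasis 𝒯 m M) {N : ℕ} (A : Matrix (Fin M) (Fin N) ℝ) :
    0 ≤ B.colNormSq A := Finset.sum_nonneg fun _ _ => sq_nonneg _

theorem norm_toFE_sq (B : NodalBasis 𝒯 m M) (c : Fin M → ℝ) :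
    ‖toL2 (B.toFE c)‖ ^ 2 = ∑ i, ∑ k, c k * B.mass k i * c i := by
  have h : toL2 (B.toFE c) = ∑ i, c i • toL2 (B.basis i : H10 Ω) := by
    rw [toFE, Fintype.linearCombination_apply, map_sum]
    simp_rw [map_smul]
  rw [h]
  exact norm_sum_smul_sq (fun i => toL2 (B.basis i : H10 Ω)) c

/-- The diagonal entries of `Aᵀ M A` are the squared `L²` norms of the column functions, so no
matrix square root is needed. -/
theorem weightedFrobenius_mass (B : NodalBasis 𝒯 m M) {N : ℕ} (A : Matrix (Fin M) (Fin N) ℝ) :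
    weightedFrobenius B.mass A = Real.sqrt (B.colNormSq A) := by
  have h : Matrix.trace (A.transpose * B.mass * A) = B.colNormSq A := by
    rw [colNormSq, Matrix.trace]
    refine Finset.sum_congr rfl fun j _ => ?_
    rw [norm_toFE_sq, Matrix.diag_apply, Matrix.mul_apply]
    refine Finset.sum_congr rfl fun i _ => ?_
    rw [Matrix.mul_apply, Finset.sum_mul]
    rfl
  rw [weightedFrobenius, h]

theorem colNormSq_le_tensorNorm_sq (B : NodalBasis 𝒯 m M) {N : ℕ} {K : Fin D → ℕ} {Δt : ℝ}
    (hΔt : 0 ≤ Δt) (Ψ : Tensor M N K) (k : (i : Fin D) → Fin (K i)) :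
    Δt * B.colNormSq (Ψ k) ≤ tensorNorm Δt B.mass Ψ ^ 2 := by
  rw [tensorNorm, mul_pow, Real.sq_sqrt hΔt, ← Real.sq_sqrt (B.colNormSq_nonneg (Ψ k)),
    ← weightedFrobenius_mass]
  refine mul_le_mul_of_nonneg_left (pow_le_pow_left₀ (Real.sqrt_nonneg _) ?_ 2) hΔt
  exact le_ciSup (f := fun k => weightedFrobenius B.mass (Ψ k)) (Set.finite_range _).bddAbove k

theorem tensorNorm_sq_le (B : NodalBasis 𝒯 m M) {N : ℕ} {K : Fin D → ℕ} {Δt : ℝ}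
    (hΔt : 0 ≤ Δt) {Ψ : Tensor M N K} {X : ℝ} (hX : 0 ≤ X)
    (h : ∀ k, B.colNormSq (Ψ k) ≤ X) : tensorNorm Δt B.mass Ψ ^ 2 ≤ Δt * X := by
  rw [tensorNorm, mul_pow, Real.sq_sqrt hΔt]
  refine mul_le_mul_of_nonneg_left ?_ hΔt
  rw [← Real.sq_sqrt hX]
  refine pow_le_pow_left₀ (Real.iSup_nonneg fun k => Real.sqrt_nonneg _) ?_ 2
  refine Real.iSup_le (fun k => ?_) (Real.sqrt_nonneg _)
  refine (B.weightedFrobenius_mass (Ψ k)).le.trans ?_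
  exact Real.sqrt_le_sqrt (h k)

/-- Cauchy–Schwarz with weights `|w k|` in each column. Only the `ℓ¹` norm of the weights appears,
not the number of slices, so the bound is uniform in the sampling grid. -/
theorem colNormSq_sum_smul_le (B : NodalBasis 𝒯 m M) {N : ℕ} {ι : Type*} (t : Finset ι)
    (w : ι → ℝ) (Ψ : ι → Matrix (Fin M) (Fin N) ℝ) {X : ℝ} (h : ∀ k ∈ t, B.colNormSq (Ψ k) ≤ X) :
    B.colNormSq (∑ k ∈ t, w k • Ψ k) ≤ (∑ k ∈ t, |w k|) ^ 2 * X := by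
  have col : ∀ j, ‖toL2 (B.toFE fun i => (∑ k ∈ t, w k • Ψ k) i j)‖ ^ 2
      ≤ (∑ k ∈ t, |w k|) * ∑ k ∈ t, |w k| * ‖toL2 (B.toFE fun i => Ψ k i j)‖ ^ 2 := by
    intro j
    have he : (fun i => (∑ k ∈ t, w k • Ψ k) i j) = ∑ k ∈ t, w k • fun i => Ψ k i j := by
      ext i; simp [Matrix.sum_apply]
    have h1 : ‖toL2 (B.toFE fun i => (∑ k ∈ t, w k • Ψ k) i j)‖
        ≤ ∑ k ∈ t, |w k| * ‖toL2 (B.toFE fun i => Ψ k i j)‖ := by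
      rw [he, map_sum, map_sum]
      refine (norm_sum_le _ _).trans (le_of_eq (Finset.sum_congr rfl fun k _ => ?_))
      rw [map_smul, map_smul, norm_smul, Real.norm_eq_abs]
    refine (pow_le_pow_left₀ (norm_nonneg _) h1 2).trans ?_
    refine Finset.sum_sq_le_sum_mul_sum_of_sq_le_mul t (fun k _ => abs_nonneg _)
      (fun k _ => by positivity) fun k _ => le_of_eq (by ring)
  refine (Finset.sum_le_sum fun j _ => col j).trans ?_
  rw [← Finset.mul_sum, Finset.sum_comm, sq, mul_assoc]
  refine mul_le_mul_of_nonneg_left ?_ (Finset.sum_nonneg fun _ _ => abs_nonneg _)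
  rw [Finset.sum_mul]
  refine Finset.sum_le_sum fun k hk => ?_
  rw [← Finset.mul_sum]
  exact mul_le_mul_of_nonneg_left (h k hk) (abs_nonneg _)

theorem colNormSq_add_le (B : NodalBasis 𝒯 m M) {N : ℕ} (A A' : Matrix (Fin M) (Fin N) ℝ) :
    B.colNormSq (A + A') ≤ 2 * (B.colNormSq A + B.colNormSq A') := by
  rw [colNormSq, colNormSq, colNormSq, ← Finset.sum_add_distrib, Finset.mul_sum]
  refine Finset.sum_le_sum fun j _ => ?_
  have he : (fun i => (A + A') i j) = (fun i => A i j) + fun i => A' i j := rfl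
  rw [he, map_add, map_add]
  exact (pow_le_pow_left₀ (norm_nonneg _) (norm_add_le _ _) 2).trans (add_sq_le)

theorem colNormSq_snapshots_le (B : NodalBasis 𝒯 m M) (hΩo : IsOpen Ω)
    (hΩb : Bornology.IsBounded Ω) {lo hi : Fin D → ℝ}
    (hbox : ∀ i, lo i < hi i) {p N : ℕ} {Cu : ℝ} {u : (Fin D → ℝ) → ℕ → 𝒯.feSpace m}
    (hu : IsParamSmooth B (Set.Icc lo hi) p N Cu u) {α : Fin D → ℝ} (hα : α ∈ Set.Icc lo hi) :
    B.colNormSq (snapshots B u N α) ≤ N * (volume.real Ω * max Cu 0 ^ 2) := by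
  refine (Finset.sum_le_sum (g := fun _ => volume.real Ω * max Cu 0 ^ 2) fun j _ => ?_).trans ?_
  · have := B.norm_snapshot_sq_le hΩo hΩb hbox hu (k := j + 1) (by omega) (by omega) hα
    rwa [← B.toFE_coeffs] at this
  · simp

end LRTD.NodalBasis

/-! ### Interpolation and compression errors. -/

theorem LRTD.SamplingGrid.step_nonneg {D : ℕ} {lo hi : Fin D → ℝ} (G : SamplingGrid lo hi)
    (i : Fin D) : 0 ≤ G.step i := Real.iSup_nonneg fun _ => abs_nonneg _

theorem LRTD.SamplingGrid.stepPow_nonneg {D : ℕ} {lo hi : Fin D → ℝ} (G : SamplingGrid lo hi)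
    (q : ℕ) : 0 ≤ G.stepPow q := Finset.sum_nonneg fun i _ => pow_nonneg (G.step_nonneg i) q

/-- `stepPow` is a sum over directions, so squaring it is not doubling the exponent; Cauchy–Schwarz
costs the factor `D`. -/
theorem LRTD.SamplingGrid.stepPow_sq_le {D : ℕ} {lo hi : Fin D → ℝ} (G : SamplingGrid lo hi)
    (q : ℕ) : G.stepPow q ^ 2 ≤ D * G.stepPow (2 * q) := by
  have := sq_sum_le_card_mul_sum_sq (s := Finset.univ) (f := fun i => G.step i ^ q)
  simpa [SamplingGrid.stepPow, ← pow_mul, mul_comm] using this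

theorem LRTD.SamplingGrid.point_mem {D : ℕ} {lo hi : Fin D → ℝ} (G : SamplingGrid lo hi)
    (k : (i : Fin D) → Fin (G.K i)) : G.point k ∈ Set.Icc lo hi :=
  ⟨fun i => (G.mem i (k i)).1, fun i => (G.mem i (k i)).2⟩

/-- The `ℓ¹` norm of a tensor product of weight vectors is the product of their `ℓ¹` norms. -/
theorem LRTD.SamplingGrid.sum_abs_weights_le {D : ℕ} {lo hi : Fin D → ℝ} (G : SamplingGrid lo hi)
    {χ : (i : Fin D) → (Fin D → ℝ) → Fin (G.K i) → ℝ} {Ce : ℝ} (h : G.IsStable χ Ce)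
    {α : Fin D → ℝ} (hα : α ∈ Set.Icc lo hi) :
    ∑ k : ((i : Fin D) → Fin (G.K i)), |∏ i, χ i α (k i)| ≤ |Ce| ^ D := by
  simp_rw [Finset.abs_prod]
  rw [← Fintype.prod_sum fun i (k : Fin (G.K i)) => |χ i α k|]
  refine (Finset.prod_le_prod (fun i _ => Finset.sum_nonneg fun _ _ => abs_nonneg _)
    fun i _ => (h α hα i).trans (le_abs_self Ce)).trans ?_
  simp

theorem LRTD.contract_sub {M N D : ℕ} {K : Fin D → ℕ} (Φ Ψ : Tensor M N K)
    (x : (i : Fin D) → Fin (K i) → ℝ) : contract (Φ - Ψ) x = contract Φ x - contract Ψ x := by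
  simp [contract, smul_sub]

namespace LRTD.NodalBasis

variable {d D : ℕ} {Ω : Set (Space d)} {𝒯 : Triangulation Ω} {m M : ℕ}

/-- The interpolation error of the snapshot matrix. -/
theorem colNormSq_snapshots_sub_contract_le (B : NodalBasis 𝒯 m M) (hΩo : IsOpen Ω)
    (hΩb : Bornology.IsBounded Ω) {lo hi : Fin D → ℝ}
    (hbox : ∀ i, lo i < hi i) {p N : ℕ} {Cu : ℝ} {u : (Fin D → ℝ) → ℕ → 𝒯.feSpace m}
    (hu : IsParamSmooth B (Set.Icc lo hi) p N Cu u) (G : SamplingGrid lo hi)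
    {χ : (i : Fin D) → (Fin D → ℝ) → Fin (G.K i) → ℝ} {CI : ℝ} (hχ : G.IsAccurate χ p CI)
    {α : Fin D → ℝ} (hα : α ∈ Set.Icc lo hi) :
    B.colNormSq (snapshots B u N α - contract (snapshotTensor B u N G) fun i => χ i α)
      ≤ N * (volume.real Ω * (|CI| * G.stepPow p * max Cu 0) ^ 2) := by
  refine (Finset.sum_le_sum (g := fun _ => volume.real Ω * (|CI| * G.stepPow p * max Cu 0) ^ 2)
    fun j _ => ?_).trans (by simp)
  refine B.norm_toFE_sq_le_of_abs_rep_le hΩo hΩb fun x hx => ?_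
  have hk1 : 1 ≤ (j : ℕ) + 1 := by omega
  have hkN : (j : ℕ) + 1 ≤ N := by omega
  have h1 := hχ (fun β => B.eval (u β (j + 1)) x) ((hu _ hk1 hkN).1 x hx) α hα
  -- Interpolation in `α` commutes with evaluation at `x`, so this column at `x` is the
  -- interpolation error of the scalar function `β ↦ u^{j+1}(β)(x)`.
  have h2 : B.rep (fun i => (snapshots B u N α - contract (snapshotTensor B u N G)
      fun i => χ i α) i j) x = B.eval (u α (j + 1)) x -
      G.interp χ (fun β => B.eval (u β (j + 1)) x) α := by
    simp only [rep, SamplingGrid.interp, eval, contract, snapshots, snapshotTensor,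
      Matrix.sub_apply, Matrix.of_apply, Matrix.sum_apply, Matrix.smul_apply, smul_eq_mul, sub_mul,
      Finset.sum_sub_distrib, Finset.sum_mul, Finset.mul_sum]
    congr 1
    rw [Finset.sum_comm]
    exact Finset.sum_congr rfl fun k _ => Finset.sum_congr rfl fun i _ => mul_assoc _ _ _
  rw [h2]
  refine h1.trans ?_
  have h3 := B.cpNorm_eval_le hΩo hbox hu hk1 hkN hx
  have h4 : 0 ≤ cpNorm (Set.Icc lo hi) p fun β => B.eval (u β (j + 1)) x := by
    refine Real.sSup_nonneg ?_
    rintro _ ⟨β, _, rfl⟩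
    exact Finset.sum_nonneg fun _ _ => abs_nonneg _
  exact mul_le_mul (mul_le_mul_of_nonneg_right (le_abs_self CI) (G.stepPow_nonneg p)) h3 h4
    (mul_nonneg (abs_nonneg _) (G.stepPow_nonneg p))

/-- The error of the interpolated slice of an approximate snapshot tensor. -/
theorem colNormSq_snapshots_sub_le (B : NodalBasis 𝒯 m M) (hΩo : IsOpen Ω)
    (hΩb : Bornology.IsBounded Ω) {lo hi : Fin D → ℝ}
    (hbox : ∀ i, lo i < hi i) {p N : ℕ} (hN : 0 < N) {T : ℝ} (hT : 0 < T) {Cu : ℝ}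
    {u : (Fin D → ℝ) → ℕ → 𝒯.feSpace m}
    (hu : IsParamSmooth B (Set.Icc lo hi) p N Cu u) (G : SamplingGrid lo hi)
    {χ : (i : Fin D) → (Fin D → ℝ) → Fin (G.K i) → ℝ} {CI Ce : ℝ} (hs : G.IsStable χ Ce)
    (hχ : G.IsAccurate χ p CI) {ε : ℝ} {Φ : Tensor M N G.K}
    (hΦ : tensorNorm (T / N) B.mass (Φ - snapshotTensor B u N G)
      ≤ ε * tensorNorm (T / N) B.mass (snapshotTensor B u N G))
    {α : Fin D → ℝ} (hα : α ∈ Set.Icc lo hi) :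
    T / N * B.colNormSq (snapshots B u N α - contract Φ fun i => χ i α)
      ≤ 2 * T * volume.real Ω * max Cu 0 ^ 2 *
        (CI ^ 2 * D * G.stepPow (2 * p) + (|Ce| ^ D) ^ 2 * ε ^ 2) := by
  have hNr : (0 : ℝ) < N := by exact_mod_cast hN
  have hΔ : 0 < T / N := by positivity
  set Y := volume.real Ω * max Cu 0 ^ 2 with hY
  have hY0 : 0 ≤ Y := by positivity
  have e1 := B.colNormSq_snapshots_sub_contract_le hΩo hΩb hbox hu G hχ hα
  -- `N` snapshots of squared norm at most `Y`, with `Δt * N = T`: the relative accuracy `ε` becomes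
  -- an absolute one.
  have e2 : tensorNorm (T / N) B.mass (snapshotTensor B u N G) ^ 2 ≤ T * Y := by
    refine (B.tensorNorm_sq_le hΔ.le (X := N * Y) (by positivity) fun k =>
      B.colNormSq_snapshots_le hΩo hΩb hbox hu (G.point_mem k)).trans (le_of_eq ?_)
    field_simp
  have n0 : 0 ≤ tensorNorm (T / N) B.mass (Φ - snapshotTensor B u N G) :=
    mul_nonneg (Real.sqrt_nonneg _) (Real.iSup_nonneg fun k => Real.sqrt_nonneg _)
  have e3 : ∀ k, B.colNormSq ((Φ - snapshotTensor B u N G) k) ≤ ε ^ 2 * (N * Y) := by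
    intro k
    have h1 := B.colNormSq_le_tensorNorm_sq hΔ.le (Φ - snapshotTensor B u N G) k
    have h2 := pow_le_pow_left₀ n0 hΦ 2
    rw [mul_pow] at h2
    have h3 := (h1.trans h2).trans (mul_le_mul_of_nonneg_left e2 (sq_nonneg ε))
    have h4 : T / N * B.colNormSq ((Φ - snapshotTensor B u N G) k)
        ≤ T / N * (ε ^ 2 * (N * Y)) := h3.trans (le_of_eq (by field_simp))
    exact le_of_mul_le_mul_left h4 hΔ
  -- The compression error of every slice is of size `ε`, and interpolation amplifies it at most by
  -- the `ℓ¹` norm of the weights.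
  have e4 : B.colNormSq (contract (snapshotTensor B u N G) (fun i => χ i α)
      - contract Φ fun i => χ i α) ≤ (|Ce| ^ D) ^ 2 * (ε ^ 2 * (N * Y)) := by
    have h1 : contract (snapshotTensor B u N G) (fun i => χ i α) - contract Φ (fun i => χ i α)
        = ∑ k, (-∏ i, χ i α (k i)) • (Φ - snapshotTensor B u N G) k := by
      rw [← neg_sub, ← contract_sub, contract]
      simp [neg_smul]
    rw [h1]
    refine (B.colNormSq_sum_smul_le _ _ _ fun k _ => e3 k).trans ?_
    refine mul_le_mul_of_nonneg_right (pow_le_pow_left₀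
      (Finset.sum_nonneg fun _ _ => abs_nonneg _) ?_ 2) (by positivity)
    simp_rw [abs_neg]
    exact G.sum_abs_weights_le hs hα
  have e5 := B.colNormSq_add_le
    (snapshots B u N α - contract (snapshotTensor B u N G) fun i => χ i α)
    (contract (snapshotTensor B u N G) (fun i => χ i α) - contract Φ fun i => χ i α)
  rw [sub_add_sub_cancel] at e5
  have e6 : (|CI| * G.stepPow p * max Cu 0) ^ 2
      ≤ CI ^ 2 * (D * G.stepPow (2 * p)) * max Cu 0 ^ 2 := by
    rw [mul_pow, mul_pow, sq_abs]
    exact mul_le_mul_of_nonneg_right (mul_le_mul_of_nonneg_left (G.stepPow_sq_le p) (sq_nonneg _))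
      (sq_nonneg _)
  have e7 := mul_le_mul_of_nonneg_left e6 (show 0 ≤ N * volume.real Ω by positivity)
  have e8 : B.colNormSq (snapshots B u N α - contract Φ fun i => χ i α)
      ≤ N * (2 * Y * (CI ^ 2 * D * G.stepPow (2 * p) + (|Ce| ^ D) ^ 2 * ε ^ 2)) := by
    rw [hY] at e4 ⊢
    linarith
  refine (mul_le_mul_of_nonneg_left e8 hΔ.le).trans (le_of_eq ?_)
  rw [hY]; field_simp

end LRTD.NodalBasis

/-! ### Truncation of a perturbed matrix. -/

theorem sum_sq_add_le {ι κ : Type*} (s : Finset ι) (t : Finset κ) (a b : ι → κ → ℝ) :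
    ∑ i ∈ s, ∑ j ∈ t, (a i j + b i j) ^ 2
      ≤ 2 * ∑ i ∈ s, ∑ j ∈ t, a i j ^ 2 + 2 * ∑ i ∈ s, ∑ j ∈ t, b i j ^ 2 := by
  simp_rw [Finset.mul_sum, ← Finset.sum_add_distrib]
  refine Finset.sum_le_sum fun i _ => Finset.sum_le_sum fun j _ => ?_
  nlinarith [sq_nonneg (a i j - b i j)]

/-- Approximation of a matrix `U` by the truncated singular value decomposition of a nearby
matrix `A`. -/
theorem LRTD.IsSVD.exists_truncation_near {M N : ℕ} {A : Matrix (Fin M) (Fin N) ℝ}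
    {S : Matrix (Fin M) (Fin M) ℝ} {σ : ℕ → ℝ} {V : Matrix (Fin N) (Fin N) ℝ}
    (h : IsSVD A S σ V) (U : Matrix (Fin M) (Fin N) ℝ) {E : Matrix (Fin N) (Fin N) ℝ}
    (hE : E ∈ Matrix.orthogonalGroup (Fin N) ℝ) {ℓ : ℕ} (I : Finset (Fin N))
    (hI : N ≤ I.card + ℓ) :
    ∃ W : Matrix (Fin M) (Fin N) ℝ, (∀ j, (fun i => W i j) ∈ colSpan S ℓ) ∧
      ∑ j, ∑ i, (U - W) i j ^ 2
        ≤ 6 * ∑ j, ∑ i, (U - A) i j ^ 2 + 4 * ∑ i ∈ I, ∑ r, (U * E) r i ^ 2 := by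
  obtain ⟨W, hW, hWe⟩ := h.exists_truncation ℓ
  refine ⟨W, hW, ?_⟩
  -- Two splittings, `U - W = (U - A) + (A - W)` and `A E = U E - (U - A) E`, each with factor 2: `U
  -- - A` collects `2 + 2 * 2 = 6` and `U E` collects `2 * 2 = 4`.
  have h1 := sum_sq_add_le Finset.univ Finset.univ (fun j i => (U - A) i j) fun j i => (A - W) i j
  have h2 := sum_sq_add_le I Finset.univ (fun j i => (U * E) i j) fun j i => -((U - A) * E) i j
  have e1 : ∀ j i, (U - A) i j + (A - W) i j = (U - W) i j := fun j i => by
    simp only [Matrix.sub_apply]; ring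
  have e2 : ∀ j i, (U * E) i j + -((U - A) * E) i j = (A * E) i j := fun j i => by
    rw [Matrix.sub_mul, Matrix.sub_apply]; ring
  simp_rw [e1] at h1
  simp_rw [e2, neg_sq] at h2
  have h3 := h.tail_le hE I hI
  have h4 : ∑ i ∈ I, ∑ r, ((U - A) * E) r i ^ 2 ≤ ∑ j, ∑ i, (U - A) i j ^ 2 := by
    refine (Finset.sum_le_sum_of_subset_of_nonneg (Finset.subset_univ I) fun i _ _ =>
      Finset.sum_nonneg fun r _ => sq_nonneg _).trans (le_of_eq ?_)
    rw [Finset.sum_comm, Finset.sum_comm (f := fun j i => (U - A) i j ^ 2)]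
    exact Finset.sum_congr rfl fun r _ => sum_sq_mul_orthogonal hE _ r
  rw [hWe] at h1
  linarith

/-- The Rayleigh quotient of a unit eigenvector, written as the double sum that `norm_sum_smul_sq`
produces. -/
theorem Matrix.IsHermitian.sum_mul_eigenvector {n : Type*} [Fintype n] [DecidableEq n]
    {K : Matrix n n ℝ} (hK : K.IsHermitian) (i : n) :
    ∑ a, ∑ k, (hK.eigenvectorUnitary : Matrix n n ℝ) k i * K a k *
      (hK.eigenvectorUnitary : Matrix n n ℝ) a i = hK.eigenvalues i := by
  have h1 : ∀ a, ∑ k, hK.eigenvectorBasis i k * K a k * hK.eigenvectorBasis i a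
      = hK.eigenvalues i * hK.eigenvectorBasis i a ^ 2 := by
    intro a
    have h2 := congrFun (hK.mulVec_eigenvectorBasis i) a
    rw [Matrix.mulVec, dotProduct, Pi.smul_apply, smul_eq_mul] at h2
    rw [sq, ← mul_assoc, ← h2, Finset.sum_mul]
    exact Finset.sum_congr rfl fun k _ => by rw [mul_comm (K a k)]
  simp_rw [hK.eigenvectorUnitary_apply, h1]
  have h3 := EuclideanSpace.norm_sq_eq (hK.eigenvectorBasis i)
  rw [hK.eigenvectorBasis.orthonormal.1 i] at h3
  simp only [Real.norm_eq_abs, sq_abs, one_pow] at h3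
  rw [← Finset.mul_sum, ← h3, mul_one]

/-! ### Best approximation and inverse inequality constants. -/

/-- Pythagoras; of the chosen element `l2Proj W v` only membership in `W` and orthogonality are
used. -/
theorem norm_toL2_sub_l2Proj_le {d : ℕ} {Ω : Set (Space d)} (W : Submodule ℝ (H10 Ω))
    [FiniteDimensional ℝ W] (v : H10 Ω) {w : H10 Ω} (hw : w ∈ W) :
    ‖toL2 (v - l2Proj W v)‖ ^ 2 ≤ ‖toL2 (v - w)‖ ^ 2 := by
  obtain ⟨hP, ho⟩ : l2Proj W v ∈ W ∧
      ∀ z ∈ W, inner ℝ (toL2 (v - l2Proj W v)) (toL2 z) = 0 :=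
    Classical.choose_spec (exists_l2Proj W v)
  have h1 : toL2 (v - w) = toL2 (v - l2Proj W v) + toL2 (l2Proj W v - w) := by
    rw [← map_add, sub_add_sub_cancel]
  rw [h1, sq, sq, norm_add_sq_eq_norm_sq_add_norm_sq_of_inner_eq_zero _ _
    (ho _ (W.sub_mem hP hw))]
  exact le_add_of_nonneg_right (mul_self_nonneg _)

theorem l2Proj_mem {d : ℕ} {Ω : Set (Space d)} (W : Submodule ℝ (H10 Ω))
    [FiniteDimensional ℝ W] (v : H10 Ω) : l2Proj W v ∈ W :=
  (Classical.choose_spec (exists_l2Proj W v)).1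

theorem invConst_le {d : ℕ} {Ω : Set (Space d)} {W : Submodule ℝ (H10 Ω)} {c : ℝ} (hc : 0 ≤ c)
    (h : ∀ v ∈ W, ‖v‖ ≤ c * ‖toL2 v‖) : invConst W ≤ c :=
  csInf_le ⟨0, fun _ h => h.1⟩ ⟨hc, h⟩

/-- Some admissible `c` must exist, because the real infimum of the empty set is `0`; its value does
not enter the conclusion. -/
theorem norm_le_invConst_mul {d : ℕ} {Ω : Set (Space d)} {W : Submodule ℝ (H10 Ω)} {c : ℝ}
    (hc : 0 ≤ c) (h : ∀ v ∈ W, ‖v‖ ≤ c * ‖toL2 v‖) {v : H10 Ω} (hv : v ∈ W) :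
    ‖v‖ ≤ invConst W * ‖toL2 v‖ := by
  rcases (norm_nonneg (toL2 v)).eq_or_lt with h0 | h0
  · have := h v hv
    rw [← h0, mul_zero] at this
    rw [← h0, mul_zero]; exact this
  · rw [← div_le_iff₀ h0]
    exact le_csInf ⟨c, hc, h⟩ fun b hb => (div_le_iff₀ h0).2 (hb.2 v hv)

namespace LRTD.NodalBasis

variable {d D : ℕ} {Ω : Set (Space d)} {𝒯 : Triangulation Ω} {m M : ℕ}

/-- The coefficient map into `L²` is injective on a finite-dimensional space. The resulting `c` may
depend on the mesh; it serves only to make `invConst` and `Cinv` a genuine infimum and supremum. -/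
theorem exists_inverse_inequality (B : NodalBasis 𝒯 m M) {κ μ : ℝ} (hμ : 0 < μ)
    (h : ∀ c : Fin M → ℝ, μ * ∑ i, c i ^ 2 ≤ κ * ‖toL2 (B.toFE c)‖ ^ 2) :
    ∃ c : ℝ, 0 ≤ c ∧ ∀ v ∈ 𝒯.feSpace m, ‖v‖ ≤ c * ‖toL2 v‖ := by
  have hinj : Function.Injective (toL2.comp B.toFE) := by
    rw [injective_iff_map_eq_zero]
    intro c hc
    have h1 := h c
    rw [show toL2 (B.toFE c) = 0 from hc] at h1
    have h2 : ∑ i, c i ^ 2 ≤ 0 := by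
      simp only [norm_zero, ne_eq, OfNat.ofNat_ne_zero, not_false_eq_true, zero_pow, mul_zero] at h1
      exact nonpos_of_mul_nonpos_right h1 hμ
    ext i
    have h3 := (Finset.single_le_sum (f := fun i => c i ^ 2) (fun _ _ => sq_nonneg _)
      (Finset.mem_univ i)).trans h2
    exact pow_eq_zero_iff two_ne_zero |>.1 (le_antisymm h3 (sq_nonneg _))
  obtain ⟨c, hc, hb⟩ := LinearMap.exists_norm_le_of_injective _ hinj B.toFE
  refine ⟨c, hc, fun v hv => ?_⟩
  have := hb (B.coeffs ⟨v, hv⟩)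
  rw [LinearMap.comp_apply, toFE_coeffs] at this
  exact this

/-- All the spaces `V_h(β) + Ũ_h` lie in `V_h`, so `c` bounds their constants uniformly and the
supremum `Cinv` is not a default value. -/
theorem norm_le_Cinv_mul (B : NodalBasis 𝒯 m M) {K : Fin D → ℕ} {N : ℕ} {c : ℝ} (hc : 0 ≤ c)
    (h : ∀ v ∈ 𝒯.feSpace m, ‖v‖ ≤ c * ‖toL2 v‖) (u : (Fin D → ℝ) → ℕ → 𝒯.feSpace m)
    {A : Set (Fin D → ℝ)} (Φ : Tensor M N K) {α : Fin D → ℝ} (hα : α ∈ A) {v : H10 Ω}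
    (hv : v ∈ snapshotSpace u N α ⊔ (fiberSpan Φ).map B.toFE) :
    ‖v‖ ≤ Cinv B u A Φ * ‖toL2 v‖ := by
  have hsub : ∀ β, ∀ v ∈ snapshotSpace u N β ⊔ (fiberSpan Φ).map B.toFE, ‖v‖ ≤ c * ‖toL2 v‖ := by
    intro β v hv
    refine h v ((sup_le ?_ ?_ : _ ≤ 𝒯.feSpace m) hv)
    · refine Submodule.span_le.2 ?_
      rintro _ ⟨k, -, -, rfl⟩
      exact (u β k).2
    · rintro _ ⟨w, -, rfl⟩
      exact B.toFE_mem w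
  refine (norm_le_invConst_mul hc (hsub α) hv).trans
    (mul_le_mul_of_nonneg_right ?_ (norm_nonneg _))
  refine le_csSup ⟨c, ?_⟩ ⟨α, hα, rfl⟩
  rintro _ ⟨β, -, rfl⟩
  exact invConst_le hc (hsub β)

/-! ### Eigenvalues of the correlation matrix and the `L²` projection error. -/

theorem toFE_snapshots_mul (B : NodalBasis 𝒯 m M) (u : (Fin D → ℝ) → ℕ → 𝒯.feSpace m) (N : ℕ)
    (α : Fin D → ℝ) (E : Matrix (Fin N) (Fin N) ℝ) (i : Fin N) :
    B.toFE (fun r => (snapshots B u N α * E) r i)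
      = ∑ j, E j i • (u α ((j : ℕ) + 1) : H10 Ω) := by
  have h : (fun r => (snapshots B u N α * E) r i)
      = ∑ j, E j i • B.coeffs (u α ((j : ℕ) + 1)) := by
    ext r
    simp [Matrix.mul_apply, snapshots, mul_comm]
  rw [h, map_sum]
  simp_rw [map_smul, toFE_coeffs]

/-- The eigenvalues of the correlation matrix are the squared norms of the POD modes. -/
theorem norm_snapshots_mul_eigenvector_sq (B : NodalBasis 𝒯 m M)
    (u : (Fin D → ℝ) → ℕ → 𝒯.feSpace m) {N : ℕ} (hN : 0 < N) (α : Fin D → ℝ) (i : Fin N) :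
    ‖toL2 (B.toFE fun r => (snapshots B u N α *
      ((correlation_isHermitian u N α).eigenvectorUnitary : Matrix (Fin N) (Fin N) ℝ)) r i)‖ ^ 2
      = N * (correlation_isHermitian u N α).eigenvalues i := by
  have hNr : (N : ℝ) ≠ 0 := by exact_mod_cast hN.ne'
  have hin : ∀ a k : Fin N, inner ℝ (toL2 (u α ((a : ℕ) + 1) : H10 Ω))
      (toL2 (u α ((k : ℕ) + 1) : H10 Ω)) = N * correlation u N α a k := fun a k => by
    rw [correlation, Matrix.of_apply, mul_inv_cancel_left₀ hNr, real_inner_comm]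
  rw [toFE_snapshots_mul, map_sum]
  simp_rw [map_smul]
  rw [norm_sum_smul_sq fun j : Fin N => toL2 (u α ((j : ℕ) + 1) : H10 Ω),
    ← (correlation_isHermitian u N α).sum_mul_eigenvector i, Finset.mul_sum]
  refine Finset.sum_congr rfl fun a _ => ?_
  rw [Finset.mul_sum]
  refine Finset.sum_congr rfl fun k _ => ?_
  rw [hin, mul_left_comm, mul_assoc]

theorem eigenvalues_correlation_nonneg (B : NodalBasis 𝒯 m M)
    (u : (Fin D → ℝ) → ℕ → 𝒯.feSpace m) {N : ℕ} (hN : 0 < N) (α : Fin D → ℝ) (i : Fin N) :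
    0 ≤ (correlation_isHermitian u N α).eigenvalues i := by
  have h := B.norm_snapshots_mul_eigenvector_sq u hN α i
  have hNr : (0 : ℝ) < N := by exact_mod_cast hN
  exact nonneg_of_mul_nonneg_right (h ▸ sq_nonneg _) hNr

/-- The positions, in the unordered enumeration, of all but the `ℓ` largest eigenvalues. -/
noncomputable def tailIndices (N ℓ : ℕ) : Finset (Fin N) :=
  (Finset.univ.filter fun i : Fin (Fintype.card (Fin N)) => ℓ ≤ i.val).map
    (Fintype.equivOfCardEq (Fintype.card_fin _)).toEmbedding

theorem le_card_tailIndices (N ℓ : ℕ) : N ≤ (tailIndices N ℓ).card + ℓ := by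
  rw [tailIndices, Finset.card_map]
  have h := Finset.card_filter_add_card_filter_not (s := Finset.univ)
    (fun i : Fin (Fintype.card (Fin N)) => ℓ ≤ i.val)
  have h2 : (Finset.univ.filter fun i : Fin (Fintype.card (Fin N)) => ¬ ℓ ≤ i.val).card ≤ ℓ := by
    refine (Finset.card_le_card_of_injOn (t := Finset.range ℓ) (fun i => i.val) (fun i hi => ?_)
      (fun i _ j _ hij => Fin.ext hij)).trans (by simp)
    simpa using hi
  simp only [Finset.card_univ, Fintype.card_fin] at h
  omega

/-- `tailIndices` uses the same equivalence by which `eigenvalues` is obtained from the sorted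
`eigenvalues₀`. -/
theorem sum_tailIndices_eigenvalues (u : (Fin D → ℝ) → ℕ → 𝒯.feSpace m) (N ℓ : ℕ)
    (α : Fin D → ℝ) :
    ∑ i ∈ tailIndices N ℓ, (correlation_isHermitian u N α).eigenvalues i
      = ∑ i with ℓ + 1 ≤ i.val + 1, (correlation_isHermitian u N α).eigenvalues₀ i := by
  rw [tailIndices, Finset.sum_map]
  simp only [add_le_add_iff_right]
  refine Finset.sum_congr rfl fun i _ => ?_
  simp [Matrix.IsHermitian.eigenvalues]

/-- The content is that the supremum is over a bounded set: eigenvalues are nonnegative, so a tail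
is at most the trace, hence at most `X`. -/
theorem sum_tailIndices_le_eigenTail (B : NodalBasis 𝒯 m M)
    (u : (Fin D → ℝ) → ℕ → 𝒯.feSpace m) {N : ℕ} (hN : 0 < N) (ℓ : ℕ) {A : Set (Fin D → ℝ)}
    {X : ℝ} (hX : ∀ β ∈ A, ∀ k, 1 ≤ k → k ≤ N → ‖toL2 (u β k : H10 Ω)‖ ^ 2 ≤ X)
    {α : Fin D → ℝ} (hα : α ∈ A) :
    ∑ i ∈ tailIndices N ℓ, (correlation_isHermitian u N α).eigenvalues i
      ≤ eigenTail u N A (ℓ + 1) := by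
  have hNr : (0 : ℝ) < N := by exact_mod_cast hN
  rw [sum_tailIndices_eigenvalues]
  refine le_csSup ⟨X, ?_⟩ ⟨α, hα, rfl⟩
  rintro _ ⟨β, hβ, rfl⟩
  change ∑ i with ℓ + 1 ≤ i.val + 1, (correlation_isHermitian u N β).eigenvalues₀ i ≤ X
  rw [← sum_tailIndices_eigenvalues]
  refine (Finset.sum_le_sum_of_subset_of_nonneg (Finset.subset_univ _) fun i _ _ =>
    B.eigenvalues_correlation_nonneg u hN β i).trans ?_
  have h := (correlation_isHermitian u N β).trace_eq_sum_eigenvalues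
  have h' : (correlation u N β).trace = ∑ i, (correlation_isHermitian u N β).eigenvalues i := h
  rw [← h', Matrix.trace]
  refine (Finset.sum_le_sum (g := fun _ => (N : ℝ)⁻¹ * X) fun i _ => ?_).trans (le_of_eq ?_)
  · rw [Matrix.diag_apply, correlation, Matrix.of_apply, real_inner_self_eq_norm_sq]
    exact mul_le_mul_of_nonneg_left (hX β hβ _ (by omega) (by omega)) (by positivity)
  · simp [hNr.ne']

/-- The `L²` error of the projection onto the local space. -/
theorem sum_norm_sub_l2Proj_sq_le (B : NodalBasis 𝒯 m M) {κ μ : ℝ} (hκ : 0 < κ)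
    (hmass : ∀ c : Fin M → ℝ, ‖toL2 (B.toFE c)‖ ^ 2 ≤ κ * (μ * ∑ i, c i ^ 2) ∧
      μ * ∑ i, c i ^ 2 ≤ κ * ‖toL2 (B.toFE c)‖ ^ 2) (hμ : 0 < μ)
    (u : (Fin D → ℝ) → ℕ → 𝒯.feSpace m) {N : ℕ} (hN : 0 < N) (α : Fin D → ℝ)
    {A : Matrix (Fin M) (Fin N) ℝ} {S : Matrix (Fin M) (Fin M) ℝ} {σ : ℕ → ℝ}
    {V : Matrix (Fin N) (Fin N) ℝ} (h : IsSVD A S σ V) (ℓ : ℕ) :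
    ∑ j : Fin N, ‖toL2 ((u α (j + 1) : H10 Ω)
        - l2Proj (localSpace B S ℓ) (u α (j + 1) : H10 Ω))‖ ^ 2
      ≤ κ ^ 2 * (6 * B.colNormSq (snapshots B u N α - A) +
        4 * (N * ∑ i ∈ tailIndices N ℓ, (correlation_isHermitian u N α).eigenvalues i)) := by
  set U := snapshots B u N α with hU
  have hK := correlation_isHermitian u N α
  set E : Matrix (Fin N) (Fin N) ℝ := ↑(hK.eigenvectorUnitary) with hE
  have hEo : E ∈ Matrix.orthogonalGroup (Fin N) ℝ := hK.eigenvectorUnitary.2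
  -- The orthonormal family tested is that of the `L²` correlation eigenvectors, not the right
  -- singular vectors of `U`.
  obtain ⟨W, hW, hWe⟩ := h.exists_truncation_near U hEo (tailIndices N ℓ) (le_card_tailIndices N ℓ)
  have h1 : ∀ j : Fin N, ‖toL2 ((u α (j + 1) : H10 Ω)
      - l2Proj (localSpace B S ℓ) (u α (j + 1) : H10 Ω))‖ ^ 2
      ≤ κ * (μ * ∑ i, (U - W) i j ^ 2) := by
    intro j
    have hmem : B.toFE (fun i => W i j) ∈ localSpace B S ℓ := Submodule.mem_map_of_mem (hW j)
    refine (norm_toL2_sub_l2Proj_le _ _ hmem).trans ?_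
    have he : (u α (j + 1) : H10 Ω) - B.toFE (fun i => W i j)
        = B.toFE fun i => (U - W) i j := by
      rw [← B.toFE_coeffs, ← map_sub]
      rfl
    rw [he]
    exact (hmass _).1
  refine (Finset.sum_le_sum fun j _ => h1 j).trans ?_
  rw [← Finset.mul_sum, ← Finset.mul_sum]
  -- One `κ` was spent passing from `L²` to coefficients; the second is spent here on the way back,
  -- and `μ` disappears.
  have h2 : μ * ∑ j, ∑ i, (U - A) i j ^ 2 ≤ κ * B.colNormSq (U - A) := by
    rw [colNormSq, Finset.mul_sum, Finset.mul_sum]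
    exact Finset.sum_le_sum fun j _ => (hmass _).2
  have h3 : μ * ∑ i ∈ tailIndices N ℓ, ∑ r, (U * E) r i ^ 2
      ≤ κ * (N * ∑ i ∈ tailIndices N ℓ, hK.eigenvalues i) := by
    rw [Finset.mul_sum, Finset.mul_sum, Finset.mul_sum]
    refine Finset.sum_le_sum fun i _ => ((hmass _).2).trans (le_of_eq ?_)
    rw [B.norm_snapshots_mul_eigenvector_sq u hN α i]
  have h4 := mul_le_mul_of_nonneg_left hWe hμ.le
  have h5 : μ * ∑ j, ∑ i, (U - W) i j ^ 2 ≤ κ * (6 * B.colNormSq (U - A) +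
      4 * (N * ∑ i ∈ tailIndices N ℓ, hK.eigenvalues i)) := by linarith
  refine (mul_le_mul_of_nonneg_left h5 hκ.le).trans (le_of_eq ?_)
  ring

end LRTD.NodalBasis

/-! ### Assembly of the estimate. -/

/-- Combination of the interpolation, compression and truncation errors. -/
theorem combine_bounds {T n κ b X Y L Λ δ e a c D : ℝ} (hn : 0 < n) (hT : 0 < T) (hδ : 0 ≤ δ)
    (h1 : T / n * X ≤ T / n * (κ ^ 2 * (6 * Y + 4 * (n * L))))
    (h2 : T / n * Y ≤ b * (a * D * δ + c * e)) (h3 : L ≤ Λ) (hL : 0 ≤ L) (ha : 0 ≤ a)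
    (hc : 0 ≤ c) (hb : 0 ≤ b) (hD : 0 ≤ D) (he : 0 ≤ e) :
    T / n * X ≤ κ ^ 2 * (6 * b * (a * D + c) + 4 * T) * (e + δ + Λ) := by
  have e1 : T / n * (κ ^ 2 * (6 * Y + 4 * (n * L))) = κ ^ 2 * (6 * (T / n * Y) + 4 * (T * L)) := by
    field_simp
  rw [e1] at h1
  refine h1.trans ?_
  rw [mul_assoc]
  refine mul_le_mul_of_nonneg_left ?_ (sq_nonneg κ)
  have hΛ : 0 ≤ Λ := hL.trans h3
  have e2 := mul_le_mul_of_nonneg_left h3 hT.le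
  have p1 : 0 ≤ b * (a * D) := by positivity
  have p2 : 0 ≤ b * c := by positivity
  have q1 := mul_nonneg p1 he
  have q2 := mul_nonneg p2 hδ
  have q3 := mul_nonneg p1 hΛ
  have q4 := mul_nonneg p2 hΛ
  have q5 := mul_nonneg hT.le (add_nonneg he hδ)
  linarith

theorem LRTD.contract_col_mem_fiberSpan {M N D : ℕ} {K : Fin D → ℕ} (Φ : Tensor M N K)
    (x : (i : Fin D) → Fin (K i) → ℝ) (j : Fin N) :
    (fun i => contract Φ x i j) ∈ fiberSpan Φ := by
  have h : (fun i => contract Φ x i j) = ∑ k, (∏ r, x r (k r)) • fun i => Φ k i j := by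
    ext i
    simp [contract, Matrix.sum_apply]
  rw [h]
  exact Submodule.sum_mem _ fun k _ =>
    Submodule.smul_mem _ _ (Submodule.subset_span ⟨k, j, rfl⟩)

theorem theorem1 {d : ℕ} (hd : d = 2 ∨ d = 3)
    -- the physical domain
    (Ω : Set (Space d)) (hΩo : IsOpen Ω) (hΩb : Bornology.IsBounded Ω) (hΩn : Ω.Nonempty)
    (hΩr : interior (closure Ω) = Ω)
    -- the parameter box and the final time
    {D : ℕ} (hD : 1 ≤ D) (lo hi : Fin D → ℝ) (hbox : ∀ i, lo i < hi i)
    (T : ℝ) (hT : 0 < T)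
    -- the uniformly elliptic and continuous operators and the right-hand sides
    (L : (Fin D → ℝ) → ℝ → H10 Ω →L[ℝ] StrongDual ℝ (H10 Ω))
    (f : (Fin D → ℝ) → ℝ → StrongDual ℝ (H10 Ω))
    (ca Ca : ℝ) (hca : 0 < ca)
    (hell : ∀ α ∈ Set.Icc lo hi, ∀ t ∈ Set.Icc 0 T, ∀ v : H10 Ω, ca * ‖v‖ ^ 2 ≤ L α t v v)
    (hcont : ∀ α ∈ Set.Icc lo hi, ∀ t ∈ Set.Icc 0 T, ∀ v w : H10 Ω,
      L α t v w ≤ Ca * ‖v‖ * ‖w‖)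
    -- polynomial degree, smoothness order, and the discretization-independent constants
    (m : ℕ) (hm : 1 ≤ m) (p : ℕ) (hp : 1 ≤ p) (γ : ℝ) (hγ : 0 < γ) (Cu Ce CI : ℝ) :
    ∃ C : ℝ, 0 < C ∧
      -- every triangulation, time step, and solution of the full order model
      ∀ (𝒯 : Triangulation Ω), 𝒯.IsQuasiUniform γ →
      ∀ (M : ℕ) (B : NodalBasis 𝒯 m M) (N : ℕ), 0 < N →
      ∀ (u : (Fin D → ℝ) → ℕ → 𝒯.feSpace m), IsFOMSolution L f (Set.Icc lo hi) T N u →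
        IsParamSmooth B (Set.Icc lo hi) p N Cu u →
      -- every sampling grid with a stable and accurate interpolation procedure
      ∀ (G : SamplingGrid lo hi) (χ : (i : Fin D) → (Fin D → ℝ) → Fin (G.K i) → ℝ),
        G.IsStable χ Ce → G.IsAccurate χ p CI →
      -- every approximation of the snapshot tensor of relative accuracy `ε`
      ∀ (ε : ℝ), 0 ≤ ε → ∀ (Φ : Tensor M N G.K),
        tensorNorm (T / N) B.mass (Φ - snapshotTensor B u N G)
          ≤ ε * tensorNorm (T / N) B.mass (snapshotTensor B u N G) →
      -- every reduced dimension, parameter, and SVD of the interpolated slice; left singular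
      -- vectors for the singular value zero are taken from the universal space
      ∀ (ℓ : ℕ), ∀ α ∈ Set.Icc lo hi,
      ∀ (S : Matrix (Fin M) (Fin M) ℝ) (σ : ℕ → ℝ) (V : Matrix (Fin N) (Fin N) ℝ),
        IsSVD (contract Φ fun i => χ i α) S σ V →
        (∀ i : Fin M, (i : ℕ) < ℓ → σ i = 0 → (fun k => S k i) ∈ fiberSpan Φ) →
        T / N * ∑ j : Fin N, ‖(u α (j + 1) : H10 Ω)
              - l2Proj (localSpace B S ℓ) (u α (j + 1) : H10 Ω)‖ ^ 2
          ≤ C * Cinv B u (Set.Icc lo hi) Φ ^ 2 *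
              (ε ^ 2 + G.stepPow (2 * p) + eigenTail u N (Set.Icc lo hi) (ℓ + 1)) := by
  have hd0 : 0 < d := by omega
  obtain ⟨κ, hκ, hmass⟩ := exists_mass_equivalence hd0 hΩo hΩb hΩn hΩr hm hγ
  have hb0 : 0 ≤ 2 * T * volume.real Ω * max Cu 0 ^ 2 := by positivity
  -- `κ ^ 2` comes from the mass equivalence, 6 and 4 from the truncation, and `4 * T` from `Δt * 4
  -- N λ`; all are fixed before the mesh, the time step and the grid.
  obtain ⟨C, hC⟩ : ∃ C : ℝ, C = κ ^ 2 * (6 * (2 * T * volume.real Ω * max Cu 0 ^ 2) *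
    (CI ^ 2 * D + (|Ce| ^ D) ^ 2) + 4 * T) := ⟨_, rfl⟩
  refine ⟨C, by rw [hC]; positivity, ?_⟩
  intro 𝒯 hq M B N hN u _ hu G χ hs hχ ε _ Φ hΦ ℓ α hα S σ V hsvd h0
  obtain ⟨μ, hμ, hB⟩ := hmass 𝒯 hq M B
  obtain ⟨c, hc, hinv⟩ := B.exists_inverse_inequality hμ fun c => (hB c).2
  have hNr : (0 : ℝ) < N := by exact_mod_cast hN
  have hΔ : 0 < T / N := by positivity
  -- The inclusion that lets `Cinv` apply to the projection error: `h0` covers the zero singular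
  -- values, and the columns of the interpolated slice cover the rest.
  have hlocal : localSpace B S ℓ ≤ (fiberSpan Φ).map B.toFE :=
    Submodule.map_mono (hsvd.colSpan_le (contract_col_mem_fiberSpan Φ _) h0)
  have h1 : ∀ j : Fin N, ‖(u α (j + 1) : H10 Ω)
      - l2Proj (localSpace B S ℓ) (u α (j + 1) : H10 Ω)‖ ^ 2
      ≤ Cinv B u (Set.Icc lo hi) Φ ^ 2 * ‖toL2 ((u α (j + 1) : H10 Ω)
        - l2Proj (localSpace B S ℓ) (u α (j + 1) : H10 Ω))‖ ^ 2 := by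
    intro j
    rw [← mul_pow]
    refine pow_le_pow_left₀ (norm_nonneg _) (B.norm_le_Cinv_mul hc hinv u Φ hα ?_) 2
    refine Submodule.sub_mem _ (Submodule.mem_sup_left ?_)
      (Submodule.mem_sup_right (hlocal (l2Proj_mem _ _)))
    exact Submodule.subset_span ⟨j + 1, by omega, by omega, rfl⟩
  have h2 := B.sum_norm_sub_l2Proj_sq_le hκ hB hμ u hN α hsvd ℓ
  have h3 := B.colNormSq_snapshots_sub_le hΩo hΩb hbox hN hT hu G hs hχ hΦ hα
  have h4 := B.sum_tailIndices_le_eigenTail u hN ℓ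
    (fun β hβ k hk hkN => B.norm_snapshot_sq_le hΩo hΩb hbox hu hk hkN hβ) hα
  have h4' : 0 ≤ ∑ i ∈ NodalBasis.tailIndices N ℓ, (correlation_isHermitian u N α).eigenvalues i :=
    Finset.sum_nonneg fun i _ => B.eigenvalues_correlation_nonneg u hN α i
  have h5 := mul_le_mul_of_nonneg_left h2 hΔ.le
  have h6 := combine_bounds hNr hT (G.stepPow_nonneg (2 * p)) h5 h3 h4 h4' (sq_nonneg CI)
    (sq_nonneg (|Ce| ^ D)) hb0 (Nat.cast_nonneg D) (sq_nonneg ε)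
  calc T / N * ∑ j : Fin N, ‖(u α (j + 1) : H10 Ω)
        - l2Proj (localSpace B S ℓ) (u α (j + 1) : H10 Ω)‖ ^ 2
      ≤ T / N * (Cinv B u (Set.Icc lo hi) Φ ^ 2 * ∑ j : Fin N, ‖toL2 ((u α (j + 1) : H10 Ω)
        - l2Proj (localSpace B S ℓ) (u α (j + 1) : H10 Ω))‖ ^ 2) := by
        refine mul_le_mul_of_nonneg_left ?_ hΔ.le
        rw [Finset.mul_sum]
        exact Finset.sum_le_sum fun j _ => h1 j
    _ ≤ Cinv B u (Set.Icc lo hi) Φ ^ 2 * (C * (ε ^ 2 + G.stepPow (2 * p)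
          + eigenTail u N (Set.Icc lo hi) (ℓ + 1))) := by
        rw [mul_left_comm]
        rw [hC]
        exact mul_le_mul_of_nonneg_left h6 (sq_nonneg _)
    _ = _ := by rw [mul_left_comm, mul_assoc]
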